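/- Let $d\ge 1$, let $r_n=(r_n^1,\dots,r_n^d)\in[0,1)^d$ $(n\in\mathbb N)$ be a deterministic sequence, and let $\theta_n=(\theta_n^1,\dots,\theta_n^d)$ $(n\in\mathbb N)$ be independent random vectors on a probability space $(\Omega,\mathcal A,\mathbb P)$, each uniformly distributed on $(0,2\pi)^d$ (that is, the points $(e^{i\theta_n^1},\dots,e^{i\theta_n^d})$ are independent and uniformly distributed on the torus $\mathbb T^d$). Let $\Lambda=(\lambda_n)_{n\in\mathbb N}$ be the random sequence in the polydisc $\mathbb D^d$ given by $$\lambda_n(\omega)=\left(r_n^1e^{i\theta_n^1(\omega)},\dots,r_n^de^{i\theta_n^d(\omega)}\right).$$ For $m=(m_1,\dots,m_d)\in\mathbb N^d$ (where $0\in\mathbb N$) let $|m|=m_1+\dots+m_d$ and let $N_m\in\mathbb N\cup\{\infty\}$ be the (deterministic) number of indices $n$ such that $1-2^{-m_i}\le|\lambda_n^i|<1-2^{-(m_i+1)}$ for all $i=1,\dots,d$. Let $\mathrm H^2(\mathbb D^d)$ be the Hardy space, i.e. the reproducing kernel Hilbert space on $\mathbb D^d$ with the Szegő kernel $\prod_{i=1}^d(1-z^i\overline{w^i})^{-1}$.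 A sequence $(z_n)_{n\in\mathbb N}$ in $\mathbb D^d$ is called interpolating for $\mathrm H^2(\mathbb D^d)$ if the map $$f\mapsto\left(\prod_{i=1}^d\sqrt{1-|z_n^i|^2}\;f(z_n)\right)_{n\in\mathbb N}$$ is a bounded operator from $\mathrm H^2(\mathbb D^d)$ onto $\ell^2$. Then: (a) if $\sum_{m\in\mathbb N^d}N_m^2\,2^{-|m|}<\infty$, and at most one of the vectors $r_n$ is the zero vector (so that the points of $\Lambda$ are almost surely distinct), then $\Lambda$ is almost surely interpolating for $\mathrm H^2(\mathbb D^d)$; (b) if $\sum_{m\in\mathbb N^d}N_m^2\,2^{-|m|}=\infty$, then almost surely $\Lambda$ is not interpolating for $\mathrm H^2(\mathbb D^d)$. In other words, the event that $\Lambda$ is interpolating for $\mathrm H^2(\mathbb D^d)$ has probability $1$ in case (a) and probability $0$ in case (b). -/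

import Mathlib

open MeasureTheory ProbabilityTheory Complex
open scoped ENNReal ComplexConjugate

noncomputable section

namespace RandomHardy

/-- The unit polydisc `𝔻^d`. -/
def polydisc (d : ℕ) : Set (Fin d → ℂ) := {z | ∀ i, ‖z i‖ < 1}

/-- The Szegő kernel `s_d(z, w) = ∏ i, 1 / (1 - z i * conj (w i))` of the polydisc. -/
def szego (d : ℕ) (z w : polydisc d) : ℂ :=
  ∏ i, (1 - z.1 i * conj (w.1 i))⁻¹

/-- The Szegő kernel as an operator-valued matrix, the format of Mathlib's reproducing kernel
Hilbert spaces: `szegoKernel d z w` is multiplication by the number `szego d z w`. -/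
def szegoKernel (d : ℕ) : Matrix (polydisc d) (polydisc d) (ℂ →L[ℂ] ℂ) :=
  Matrix.of fun z w => szego d z w • ContinuousLinearMap.id ℂ ℂ

theorem szegoKernel_apply (d : ℕ) (z w : polydisc d) (c : ℂ) :
    szegoKernel d z w c = szego d z w * c := by
  simp [szegoKernel]

/-- Dividing a positive semidefinite kernel by `1 - a x * conj (a y)`, where `|a| < 1`, leaves it
positive semidefinite. -/
theorem nonneg_form_mul {X : Type*} (k : X → X → ℂ) (a : X → ℂ) (ha : ∀ x, ‖a x‖ < 1)
    (hk : ∀ (s : Finset X) (v : X → ℂ),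
      0 ≤ (∑ x ∈ s, ∑ y ∈ s, v y * conj (k y x * v x)).re)
    (s : Finset X) (v : X → ℂ) :
    0 ≤ (∑ x ∈ s, ∑ y ∈ s,
      v y * conj ((k y x * (1 - a y * conj (a x))⁻¹) * v x)).re := by
  have hsum : ∀ x y : X, HasSum (fun n : ℕ =>
      ((conj (a y)) ^ n * v y) * conj (k y x * ((conj (a x)) ^ n * v x)))
      (v y * conj ((k y x * (1 - a y * conj (a x))⁻¹) * v x)) := by
    intro x y
    have h1 : ‖conj (a y) * a x‖ < 1 := by
      rw [norm_mul, RCLike.norm_conj]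
      exact mul_lt_one_of_nonneg_of_lt_one_left (norm_nonneg _) (ha y) (ha x).le
    have h2 := (hasSum_geometric_of_norm_lt_one h1).mul_left (v y * conj (k y x * v x))
    have e1 : (fun n : ℕ => ((conj (a y)) ^ n * v y) * conj (k y x * ((conj (a x)) ^ n * v x)))
        = fun n : ℕ => v y * conj (k y x * v x) * (conj (a y) * a x) ^ n := by
      funext n
      simp only [map_mul, map_pow, conj_conj, mul_pow]
      ring
    have e2 : v y * conj ((k y x * (1 - a y * conj (a x))⁻¹) * v x)
        = v y * conj (k y x * v x) * (1 - conj (a y) * a x)⁻¹ := by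
      simp only [map_mul, map_inv₀, map_sub, map_one, conj_conj]
      ring
    rw [e1, e2]
    exact h2
  have h := hasSum_sum (s := s) fun x _ => hasSum_sum (s := s) fun y _ => hsum x y
  have hre := (Complex.reCLM.hasSum h)
  exact hre.nonneg fun n => hk s fun x => (conj (a x)) ^ n * v x

theorem nonneg_form_szego (d : ℕ) (t : Finset (Fin d)) :
    ∀ (s : Finset (polydisc d)) (v : polydisc d → ℂ),
      0 ≤ (∑ x ∈ s, ∑ y ∈ s,
        v y * conj ((∏ i ∈ t, (1 - y.1 i * conj (x.1 i))⁻¹) * v x)).re := by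
  classical
  induction t using Finset.induction_on with
  | empty =>
    intro s v
    have : (∑ x ∈ s, ∑ y ∈ s, v y * conj (1 * v x))
        = (∑ y ∈ s, v y) * conj (∑ x ∈ s, v x) := by
      rw [map_sum, Finset.sum_mul_sum, Finset.sum_comm]
      simp
    simp only [Finset.prod_empty]
    rw [this, Complex.mul_conj]
    exact_mod_cast Complex.normSq_nonneg _
  | insert j t hj ih =>
    intro s v
    have h := nonneg_form_mul (fun y x : polydisc d => ∏ i ∈ t, (1 - y.1 i * conj (x.1 i))⁻¹)
      (fun x => x.1 j) (fun x => x.2 j) ih s v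
    simpa only [Finset.prod_insert hj, mul_comm] using h

/-- The Szegő kernel is positive semidefinite. -/
theorem posSemidef_szegoKernel (d : ℕ) : (szegoKernel d).PosSemidef := by
  have key := RKHS.posSemidef_tfae (K := szegoKernel d)
  refine (key.out 0 2).mpr (And.intro ?_ fun v => ?_)
  · refine Matrix.IsHermitian.ext fun z w => ?_
    ext
    simp [szegoKernel, szego, ContinuousLinearMap.star_eq_adjoint, ContinuousLinearMap.adjoint_id, mul_comm]
  · have h := nonneg_form_szego d Finset.univ v.support v
    simpa [Finsupp.sum, szegoKernel_apply, szego] using h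

instance (d : ℕ) : Fact (szegoKernel d).PosSemidef := ⟨posSemidef_szegoKernel d⟩

/-- The Hardy space `H²(𝔻^d)`: the reproducing kernel Hilbert space of functions on `𝔻^d` whose
kernel is the Szegő kernel. -/
def Hardy (d : ℕ) : Type := RKHS.OfKernel (szegoKernel d)

instance (d : ℕ) : NormedAddCommGroup (Hardy d) :=
  inferInstanceAs (NormedAddCommGroup (RKHS.OfKernel (szegoKernel d)))

instance (d : ℕ) : InnerProductSpace ℂ (Hardy d) :=
  inferInstanceAs (InnerProductSpace ℂ (RKHS.OfKernel (szegoKernel d)))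

instance (d : ℕ) : CompleteSpace (Hardy d) :=
  inferInstanceAs (CompleteSpace (RKHS.OfKernel (szegoKernel d)))

instance (d : ℕ) : RKHS ℂ (Hardy d) (polydisc d) ℂ :=
  inferInstanceAs (RKHS ℂ (RKHS.OfKernel (szegoKernel d)) (polydisc d) ℂ)

theorem kernel_hardy (d : ℕ) : RKHS.kernel (Hardy d) = szegoKernel d :=
  RKHS.OfKernel.kernel_ofKernel

/-- The weight `∏ i, √(1 - |z i|²)`, the reciprocal of the norm of the kernel function at `z`. -/
def weight {d : ℕ} (z : polydisc d) : ℝ := ∏ i, √(1 - ‖z.1 i‖ ^ 2)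

/-- `Z` is interpolating for `H²(𝔻^d)`: the weighted restriction map
`f ↦ (∏ i, √(1 - |z_n i|²) * f (z_n))_n` is a bounded map of `H²(𝔻^d)` onto `ℓ²`. -/
def IsInterpolating {d : ℕ} (Z : ℕ → polydisc d) : Prop :=
  ∃ T : Hardy d →L[ℂ] lp (fun _ : ℕ => ℂ) 2,
    (∀ (f : Hardy d) (n : ℕ), T f n = (weight (Z n) : ℂ) * f (Z n)) ∧ Function.Surjective T

/-- The random sequence `λ_n(ω) = (r_n^i * exp (√-1 * θ_n^i(ω)))_i`. -/
def randomSeq {d : ℕ} {Ω : Type*} (r : ℕ → Fin d → ℝ) (hr : ∀ n i, r n i ∈ Set.Ico (0 : ℝ) 1)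
    (θ : ℕ → Ω → Fin d → ℝ) (ω : Ω) (n : ℕ) : polydisc d :=
  ⟨fun i => (r n i : ℂ) * Complex.exp (θ n ω i * Complex.I), fun i => by
    rw [norm_mul, Complex.norm_exp_ofReal_mul_I, mul_one, Complex.norm_real, Real.norm_eq_abs,
      abs_of_nonneg (hr n i).1]
    exact (hr n i).2⟩

/-- The dyadic shell `I_m = {z : 1 - 2^(-m_i) ≤ |z i| < 1 - 2^(-(m_i + 1)) for all i}`. -/
def shell {d : ℕ} (m : Fin d → ℕ) : Set (polydisc d) :=
  {z | ∀ i, 1 - (2⁻¹ : ℝ) ^ m i ≤ ‖z.1 i‖ ∧ ‖z.1 i‖ < 1 - (2⁻¹ : ℝ) ^ (m i + 1)}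

/-- `N_m`, the number (possibly `∞`) of indices `n` such that the points of modulus `r_n`
lie in `I_m`. -/
def shellCount {d : ℕ} (r : ℕ → Fin d → ℝ) (m : Fin d → ℕ) : ℕ∞ :=
  {n | ∀ i, 1 - (2⁻¹ : ℝ) ^ m i ≤ r n i ∧ r n i < 1 - (2⁻¹ : ℝ) ^ (m i + 1)}.encard

/-- `N_m` counts the terms of the random sequence in `I_m`, whatever `ω` is. -/
theorem encard_randomSeq_mem_shell {d : ℕ} {Ω : Type*} (r : ℕ → Fin d → ℝ)
    (hr : ∀ n i, r n i ∈ Set.Ico (0 : ℝ) 1) (θ : ℕ → Ω → Fin d → ℝ) (ω : Ω) (m : Fin d → ℕ) :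
    {n | randomSeq r hr θ ω n ∈ shell m}.encard = shellCount r m := by
  have h : ∀ n i, ‖(randomSeq r hr θ ω n).1 i‖ = r n i := fun n i => by
    simp [randomSeq, Complex.norm_exp_ofReal_mul_I, abs_of_nonneg (hr n i).1]
  simp only [shell, shellCount, Set.mem_ofPred_eq, h]

/-- The sum `∑_m N_m² 2^(-|m|)` over all multi-indices `m ∈ ℕ^d`, as an element of `[0, ∞]`. -/
def shellSum {d : ℕ} (r : ℕ → Fin d → ℝ) : ℝ≥0∞ :=
  ∑' m : Fin d → ℕ, (shellCount r m : ℝ≥0∞) ^ 2 * (2⁻¹ : ℝ≥0∞) ^ (∑ i, m i)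

end RandomHardy

end

/-! Weighted evaluation at `z` is the pairing with the normalised kernel function at `z`, so
interpolation is governed by the Gram matrix G of these unit vectors.

Convergent case. Integrating out the angles with the Poisson kernel gives, for n ≠ k in shells m and
l, E|G_nk|² ≤ 2^d ∏ 2^(-max(m_i, l_i)) (`lintegral_gramSq`, `gramFactor_le`). A weighted Schur test
(`tsum_mul_mul_maxKernel_lt_top`) bounds the double sum by a multiple of the shell sum, so G - I is
almost surely Hilbert–Schmidt. The synthesis operator T* is then bounded below on the sequences
vanishing on a finite set, hence has closed range. Its kernel is invariant under backward shifts,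
which multiply the n-th entry by the conjugate of a coordinate of the n-th point; for distinct
points this makes the kernel trivial (`eq_zero_of_adjoint_eq_zero`). So T* is bounded below and T is
onto.

Divergent case. For each Q, cut shell m into a number of radial classes depending only on Q and d,
and the angles into Q^d 2^|m| equal boxes. Two points sharing class and box have |G_nk|² ≥ (1 -
(16/Q)²)^d. A birthday argument (`ae_exists_collision`) produces such a pair almost surely for every
Q, whereas interpolation keeps |G_nk|² away from 1 (`IsInterpolating.exists_separation`). -/

namespace RandomHardy

/-! ### Sequences whose Gram matrix is a Hilbert–Schmidt perturbation of the identity -/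

section Gram

variable {H : Type*} [NormedAddCommGroup H] [InnerProductSpace ℂ H]

/-- The deviation of the Gram matrix of `u` from the identity matrix. -/
noncomputable def gramDefect (u : ℕ → H) (p : ℕ × ℕ) : ℂ :=
  inner ℂ (u p.1) (u p.2) - if p.1 = p.2 then 1 else 0

/-- Cauchy–Schwarz over pairs of indices: the Hilbert–Schmidt norm of G - I dominates its quadratic
form. -/
theorem abs_norm_sq_sum_smul_sub_le (u : ℕ → H) (F : Finset ℕ) (c : ℕ → ℂ) :
    |‖∑ n ∈ F, c n • u n‖ ^ 2 - ∑ n ∈ F, ‖c n‖ ^ 2| ≤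
      √(∑ p ∈ F ×ˢ F, ‖gramDefect u p‖ ^ 2) * ∑ n ∈ F, ‖c n‖ ^ 2 := by
  have e : ((‖∑ n ∈ F, c n • u n‖ ^ 2 - ∑ n ∈ F, ‖c n‖ ^ 2 : ℝ) : ℂ) =
      ∑ p ∈ F ×ˢ F, conj (c p.1) * c p.2 * gramDefect u p := by
    have h1 : ((‖∑ n ∈ F, c n • u n‖ ^ 2 : ℝ) : ℂ)
        = ∑ p ∈ F ×ˢ F, conj (c p.1) * c p.2 * inner ℂ (u p.1) (u p.2) := by
      have := inner_self_eq_norm_sq_to_K (𝕜 := ℂ) (∑ n ∈ F, c n • u n)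
      push_cast
      rw [show ((‖∑ n ∈ F, c n • u n‖ : ℝ) : ℂ) ^ 2 = _ from this.symm, sum_inner,
        Finset.sum_product]
      refine Finset.sum_congr rfl fun n _ => ?_
      rw [inner_sum]
      refine Finset.sum_congr rfl fun k _ => ?_
      rw [inner_smul_left, inner_smul_right]
      ring
    have h2 : ((∑ n ∈ F, ‖c n‖ ^ 2 : ℝ) : ℂ)
        = ∑ p ∈ F ×ˢ F, conj (c p.1) * c p.2 * if p.1 = p.2 then 1 else 0 := by
      rw [Finset.sum_product]
      push_cast
      refine Finset.sum_congr rfl fun n hn => ?_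
      simp [hn, Complex.conj_mul']
    rw [Complex.ofReal_sub, h1, h2, ← Finset.sum_sub_distrib]
    refine Finset.sum_congr rfl fun p _ => ?_
    rw [gramDefect]
    ring
  have h3 : |‖∑ n ∈ F, c n • u n‖ ^ 2 - ∑ n ∈ F, ‖c n‖ ^ 2| ≤
      ∑ p ∈ F ×ˢ F, ‖gramDefect u p‖ * (‖c p.1‖ * ‖c p.2‖) := by
    rw [← Real.norm_eq_abs, ← Complex.norm_real, e]
    refine (norm_sum_le _ _).trans (le_of_eq (Finset.sum_congr rfl fun p _ => ?_))
    rw [norm_mul, norm_mul, RCLike.norm_conj, mul_comm]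
  refine h3.trans ((Real.sum_mul_le_sqrt_mul_sqrt _ _ _).trans (le_of_eq ?_))
  congr 1
  have : ∑ p ∈ F ×ˢ F, (‖c p.1‖ * ‖c p.2‖) ^ 2 = (∑ n ∈ F, ‖c n‖ ^ 2) ^ 2 := by
    rw [sq (∑ n ∈ F, ‖c n‖ ^ 2), Finset.sum_mul_sum, Finset.sum_product]
    simp only [mul_pow]
  rw [this, Real.sqrt_sq (Finset.sum_nonneg fun _ _ => by positivity)]

/-- Duality: with v = ∑ ⟨u_n, f⟩ u_n, the left side A equals ⟨v, f⟩, while ‖v‖² ≤ (1 + B) A.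
Squaring A ≤ ‖v‖ ‖f‖ and cancelling one A gives the bound. -/
theorem sum_norm_inner_sq_le (u : ℕ → H) (hu : Summable fun p => ‖gramDefect u p‖ ^ 2)
    (f : H) (F : Finset ℕ) :
    ∑ n ∈ F, ‖inner ℂ (u n) f‖ ^ 2 ≤ (1 + √(∑' p, ‖gramDefect u p‖ ^ 2)) * ‖f‖ ^ 2 := by
  set B := √(∑' p, ‖gramDefect u p‖ ^ 2)
  set A := ∑ n ∈ F, ‖inner ℂ (u n) f‖ ^ 2 with hA
  have hA0 : 0 ≤ A := Finset.sum_nonneg fun _ _ => by positivity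
  set v := ∑ n ∈ F, inner ℂ (u n) f • u n with hv
  have h1 : ‖v‖ ^ 2 ≤ (1 + B) * A := by
    have h := abs_norm_sq_sum_smul_sub_le u F fun n => inner ℂ (u n) f
    have hB : √(∑ p ∈ F ×ˢ F, ‖gramDefect u p‖ ^ 2) ≤ B :=
      Real.sqrt_le_sqrt (hu.sum_le_tsum _ fun _ _ => by positivity)
    have h' := (abs_le.1 h).2
    have := mul_le_mul_of_nonneg_right hB hA0
    rw [← hA, ← hv] at h'
    linarith
  have h2 : (A : ℂ) = inner ℂ v f := by
    rw [hv, sum_inner, hA]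
    push_cast
    refine Finset.sum_congr rfl fun n _ => ?_
    rw [inner_smul_left, Complex.conj_mul']
  have h3 : A ≤ ‖v‖ * ‖f‖ := by
    have h := norm_inner_le_norm (𝕜 := ℂ) v f
    rwa [← h2, Complex.norm_real, Real.norm_eq_abs, abs_of_nonneg hA0] at h
  have h4 : A * A ≤ ((1 + B) * ‖f‖ ^ 2) * A := by
    calc A * A ≤ (‖v‖ * ‖f‖) * (‖v‖ * ‖f‖) := by gcongr
      _ = ‖v‖ ^ 2 * ‖f‖ ^ 2 := by ring
      _ ≤ (1 + B) * A * ‖f‖ ^ 2 := by gcongr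
      _ = _ := by ring
  rcases hA0.eq_or_lt with h | h
  · rw [← h]; positivity
  · exact le_of_mul_le_mul_right h4 h

/-- The analysis operator of a sequence whose Gram matrix is a Hilbert–Schmidt perturbation of the
identity. -/
theorem exists_analysis (u : ℕ → H) (hu : Summable fun p => ‖gramDefect u p‖ ^ 2) :
    ∃ T : H →L[ℂ] lp (fun _ : ℕ => ℂ) 2, ∀ f n, T f n = inner ℂ (u n) f := by
  set K := 1 + √(∑' p, ‖gramDefect u p‖ ^ 2)
  have hb : ∀ (f : H) (F : Finset ℕ),
      ∑ n ∈ F, ‖inner ℂ (u n) f‖ ^ (2 : ℝ≥0∞).toReal ≤ K * ‖f‖ ^ 2 := fun f F => by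
    simpa using sum_norm_inner_sq_le u hu f F
  let T₀ : H →ₗ[ℂ] lp (fun _ : ℕ => ℂ) 2 :=
    { toFun := fun f => ⟨fun n => inner ℂ (u n) f, memℓp_gen' (hb f)⟩
      map_add' := fun f g => by ext n; exact inner_add_right _ _ _
      map_smul' := fun c f => by ext n; exact inner_smul_right _ _ _ }
  refine ⟨T₀.mkContinuous (√K) fun f => ?_, fun f n => rfl⟩
  refine lp.norm_le_of_forall_sum_le (by simp) (by positivity) fun F => ?_
  refine (hb f F).trans (le_of_eq ?_)
  rw [ENNReal.toReal_ofNat, Real.rpow_two, mul_pow, Real.sq_sqrt (by positivity)]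

variable [CompleteSpace H]

theorem adjoint_analysis_single {u : ℕ → H} {T : H →L[ℂ] lp (fun _ : ℕ => ℂ) 2}
    (hT : ∀ f n, T f n = inner ℂ (u n) f) (n : ℕ) (a : ℂ) :
    T.adjoint (lp.single 2 n a) = a • u n := by
  refine ext_inner_right ℂ fun f => ?_
  rw [ContinuousLinearMap.adjoint_inner_left, lp.inner_single_left, hT, inner_smul_left,
    RCLike.inner_apply, mul_comm]

theorem hasSum_adjoint_analysis {u : ℕ → H} {T : H →L[ℂ] lp (fun _ : ℕ => ℂ) 2}
    (hT : ∀ f n, T f n = inner ℂ (u n) f) (c : lp (fun _ : ℕ => ℂ) 2) :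
    HasSum (fun n => c n • u n) (T.adjoint c) := by
  have h := (lp.hasSum_single (by simp) c).mapL T.adjoint
  simpa only [adjoint_analysis_single hT] using h

/-- Once finitely many indices are removed, the Hilbert–Schmidt norm of the remaining block of G - I
is at most 1/2, so that block of G is at least 1/2. -/
theorem exists_norm_le_adjoint_analysis {u : ℕ → H}
    (hu : Summable fun p => ‖gramDefect u p‖ ^ 2) {T : H →L[ℂ] lp (fun _ : ℕ => ℂ) 2}
    (hT : ∀ f n, T f n = inner ℂ (u n) f) :
    ∃ F : Finset ℕ, ∀ c : lp (fun _ : ℕ => ℂ) 2, (∀ n ∈ F, c n = 0) →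
      ‖c‖ ^ 2 ≤ 2 * ‖T.adjoint c‖ ^ 2 := by
  obtain ⟨P, hP⟩ := summable_iff_vanishing_norm.1 hu (1 / 4) (by norm_num)
  refine ⟨P.image Prod.fst, fun c hc => ?_⟩
  have h1 : HasSum (fun n => ‖c n‖ ^ 2) (‖c‖ ^ 2) := by
    simpa using lp.hasSum_norm (p := 2) (by simp) c
  have h2 := ((hasSum_adjoint_analysis hT c).norm.pow 2).const_mul 2
  refine le_of_tendsto_of_tendsto h1 h2 (Filter.Eventually.of_forall fun F => ?_)
  set F' := F \ P.image Prod.fst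
  have e1 : ∑ n ∈ F, ‖c n‖ ^ 2 = ∑ n ∈ F', ‖c n‖ ^ 2 := by
    refine (Finset.sum_subset Finset.sdiff_subset fun n hn hn' => ?_).symm
    rw [hc n (by simpa [F', hn] using hn')]; simp
  have e2 : ∑ n ∈ F, c n • u n = ∑ n ∈ F', c n • u n := by
    refine (Finset.sum_subset Finset.sdiff_subset fun n hn hn' => ?_).symm
    rw [hc n (by simpa [F', hn] using hn')]; simp
  have hB : √(∑ p ∈ F' ×ˢ F', ‖gramDefect u p‖ ^ 2) ≤ 1 / 2 := by
    -- Removing the first coordinates of `P` already makes the remaining square of index pairs miss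
    -- `P`.
    have hd : Disjoint (F' ×ˢ F') P := by
      rw [Finset.disjoint_left]
      intro p hp hpP
      rw [Finset.mem_product] at hp
      exact (Finset.mem_sdiff.1 hp.1).2 (Finset.mem_image_of_mem _ hpP)
    have h := (le_abs_self _).trans (hP _ hd).le
    calc _ ≤ √(1 / 4) := Real.sqrt_le_sqrt h
      _ = 1 / 2 := by rw [show (1 / 4 : ℝ) = (1 / 2) ^ 2 by norm_num, Real.sqrt_sq (by norm_num)]
  have h := (abs_le.1 (abs_norm_sq_sum_smul_sub_le u F' fun n => c n)).1
  have h0 : 0 ≤ ∑ n ∈ F', ‖c n‖ ^ 2 := Finset.sum_nonneg fun _ _ => by positivity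
  have := mul_le_mul_of_nonneg_right hB h0
  simp only [e1, e2]
  linarith

/-- The sequences in `ℓ²` vanishing on a finite set. -/
noncomputable def vanishingOn (F : Finset ℕ) : Submodule ℂ (lp (fun _ : ℕ => ℂ) 2) :=
  (LinearMap.pi fun n : F => (lp.evalCLM ℂ (fun _ : ℕ => ℂ) 2 n.1).toLinearMap).ker

theorem mem_vanishingOn {F : Finset ℕ} {c : lp (fun _ : ℕ => ℂ) 2} :
    c ∈ vanishingOn F ↔ ∀ n ∈ F, c n = 0 := by
  rw [vanishingOn, LinearMap.mem_ker, funext_iff]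
  simp [lp.evalCLM]

/-- T* is bounded below on a closed subspace of finite codimension, so its whole range is closed.
Being injective, it is then bounded below everywhere, and so is T T*, whose range is therefore
closed; the range is also dense because T T* is self-adjoint and injective. -/
theorem surjective_of_injective_adjoint {u : ℕ → H}
    (hu : Summable fun p => ‖gramDefect u p‖ ^ 2) {T : H →L[ℂ] lp (fun _ : ℕ => ℂ) 2}
    (hT : ∀ f n, T f n = inner ℂ (u n) f) (hinj : Function.Injective T.adjoint) :
    Function.Surjective T := by
  obtain ⟨F, hF⟩ := exists_norm_le_adjoint_analysis hu hT
  set V := vanishingOn F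
  have hVc : IsClosed (V : Set (lp (fun _ : ℕ => ℂ) 2)) := by
    have : (V : Set (lp (fun _ : ℕ => ℂ) 2)) =
        ⋂ n ∈ F, (lp.evalCLM ℂ (fun _ : ℕ => ℂ) 2 n) ⁻¹' {0} := by
      ext c
      simp [V, mem_vanishingOn, lp.evalCLM]
    rw [this]
    exact isClosed_biInter fun n _ => isClosed_singleton.preimage (ContinuousLinearMap.continuous _)
  have : CompleteSpace V := hVc.completeSpace_coe
  have hcl : IsClosed (V.map T.adjoint.toLinearMap : Set H) := by
    have ha : AntilipschitzWith (NNReal.sqrt 2) (T.adjoint ∘L V.subtypeL) := by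
      refine AddMonoidHomClass.antilipschitz_of_bound _ fun c => ?_
      have h := hF c (mem_vanishingOn.1 c.2)
      have := Real.sqrt_le_sqrt h
      rw [Real.sqrt_sq (norm_nonneg _), Real.sqrt_mul (by norm_num),
        Real.sqrt_sq (norm_nonneg _)] at this
      simpa using this
    have h := ha.isClosed_range (ContinuousLinearMap.uniformContinuous _)
    convert h using 1
    ext x
    simp
  have : V.CoFG := Submodule.CoFG.ker _
  have hr : IsClosed (Set.range T.adjoint) :=
    LinearMap.isClosed_range_of_isClosed_map_of_finiteDimensional_quotient hcl
  obtain ⟨K, hK⟩ := T.adjoint.antilipschitz_of_injective_of_isClosed_range hinj hr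
  have hK' : AntilipschitzWith (K ^ 2) (T ∘L T.adjoint) := by
    refine AddMonoidHomClass.antilipschitz_of_bound _ fun c => ?_
    have h1 : ‖c‖ ≤ K * ‖T.adjoint c‖ := by simpa using hK.le_mul_dist c 0
    -- Here ‖T* c‖² = ⟨c, T T* c⟩ carries the lower bound from T* over to T T*.
    have h2 : ‖T.adjoint c‖ ^ 2 ≤ ‖c‖ * ‖T (T.adjoint c)‖ := by
      have h := norm_inner_le_norm (𝕜 := ℂ) c (T (T.adjoint c))
      rw [← ContinuousLinearMap.adjoint_inner_left, inner_self_eq_norm_sq_to_K] at h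
      simpa using h
    rcases (norm_nonneg c).eq_or_lt with h | h
    · rw [← h]; positivity
    · refine le_of_mul_le_mul_left ?_ h
      calc ‖c‖ * ‖c‖ ≤ (K * ‖T.adjoint c‖) * (K * ‖T.adjoint c‖) := by gcongr
        _ = K ^ 2 * ‖T.adjoint c‖ ^ 2 := by ring
        _ ≤ K ^ 2 * (‖c‖ * ‖T (T.adjoint c)‖) := by gcongr
        _ = ‖c‖ * ((K ^ 2 : NNReal) * ‖(T ∘L T.adjoint) c‖) := by
          rw [ContinuousLinearMap.comp_apply]; push_cast; ring
  have hcl' := hK'.isClosed_range (ContinuousLinearMap.uniformContinuous _)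
  have hker : (T ∘L T.adjoint).ker = ⊥ := LinearMap.ker_eq_bot.2 hK'.injective
  have horth : (T ∘L T.adjoint).rangeᗮ = ⊥ := by
    rw [ContinuousLinearMap.orthogonal_range, ContinuousLinearMap.adjoint_comp,
      ContinuousLinearMap.adjoint_adjoint, hker]
  have : CompleteSpace (T ∘L T.adjoint).range := IsClosed.completeSpace_coe (hs := hcl')
  have htop := (Submodule.orthogonal_eq_bot_iff).1 horth
  intro y
  obtain ⟨c, hc⟩ := LinearMap.range_eq_top.1 htop y
  exact ⟨T.adjoint c, hc⟩

end Gram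
-- Kernel functions of the Hardy space and the backward shift
section Kernel

variable {d : ℕ}

/-- The normalised kernel function at `z`. -/
noncomputable def unitKer (z : polydisc d) : Hardy d :=
  (weight z : ℂ) • RKHS.kerFun (Hardy d) z (1 : ℂ)

theorem inner_unitKer (z : polydisc d) (f : Hardy d) :
    inner ℂ (unitKer z) f = (weight z : ℂ) * f z := by
  rw [unitKer, inner_smul_left, RKHS.kerFun_inner, Complex.conj_ofReal]
  simp

theorem kerFun_one_apply (w z : polydisc d) :
    RKHS.kerFun (Hardy d) w (1 : ℂ) z = szego d z w := by
  rw [RKHS.kerFun_apply, kernel_hardy, szegoKernel_apply, mul_one]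

theorem unitKer_apply (w z : polydisc d) : unitKer w z = (weight w : ℂ) * szego d z w := by
  rw [unitKer, RKHS.coe_smul, Pi.smul_apply, kerFun_one_apply, smul_eq_mul]

theorem one_sub_norm_sq_pos (z : polydisc d) (i : Fin d) : 0 < 1 - ‖z.1 i‖ ^ 2 := by
  have := z.2 i
  nlinarith [norm_nonneg (z.1 i)]

theorem weight_sq (z : polydisc d) : weight z ^ 2 = ∏ i, (1 - ‖z.1 i‖ ^ 2) := by
  rw [weight, ← Finset.prod_pow]
  exact Finset.prod_congr rfl fun i _ => Real.sq_sqrt (one_sub_norm_sq_pos z i).le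

theorem norm_inner_unitKer_sq (z w : polydisc d) :
    ‖inner ℂ (unitKer z) (unitKer w)‖ ^ 2 =
      ∏ i, (1 - ‖z.1 i‖ ^ 2) * (1 - ‖w.1 i‖ ^ 2) / ‖1 - z.1 i * conj (w.1 i)‖ ^ 2 := by
  rw [inner_unitKer, unitKer_apply, norm_mul, norm_mul, mul_pow, mul_pow, Complex.norm_real,
    Complex.norm_real, Real.norm_eq_abs, Real.norm_eq_abs, sq_abs, sq_abs, weight_sq, weight_sq,
    szego, norm_prod, ← Finset.prod_pow, ← Finset.prod_mul_distrib, ← Finset.prod_mul_distrib]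
  refine Finset.prod_congr rfl fun i _ => ?_
  rw [norm_inv, inv_pow]
  ring

theorem inner_unitKer_self (z : polydisc d) : inner ℂ (unitKer z) (unitKer z) = 1 := by
  have h : ((weight z ^ 2 : ℝ) : ℂ) * szego d z z = 1 := by
    rw [weight_sq, szego, Complex.ofReal_prod, ← Finset.prod_mul_distrib]
    refine Finset.prod_eq_one fun i _ => ?_
    have := (one_sub_norm_sq_pos z i).ne'
    rw [Complex.mul_conj']
    push_cast
    exact mul_inv_cancel₀ (by exact_mod_cast this)
  rw [inner_unitKer, unitKer_apply, ← mul_assoc, ← h]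
  push_cast
  ring

theorem norm_unitKer (z : polydisc d) : ‖unitKer z‖ = 1 := by
  have h := inner_self_eq_norm_sq_to_K (𝕜 := ℂ) (unitKer z)
  rw [inner_unitKer_self] at h
  have h' : ‖unitKer z‖ ^ 2 = 1 := by
    rw [← Complex.ofReal_inj]
    push_cast
    exact h.symm
  nlinarith [norm_nonneg (unitKer z)]

theorem continuous_szego : Continuous fun p : polydisc d × polydisc d => szego d p.1 p.2 := by
  refine continuous_finsetProd _ fun i _ => Continuous.inv₀ ?_ fun p h => ?_
  · exact continuous_const.sub (((continuous_apply i).comp (continuous_subtype_val.comp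
      continuous_fst)).mul (Complex.continuous_conj.comp ((continuous_apply i).comp
      (continuous_subtype_val.comp continuous_snd))))
  · have h1 : p.1.1 i * conj (p.2.1 i) = 1 := (sub_eq_zero.1 h).symm
    have h2 : ‖p.1.1 i * conj (p.2.1 i)‖ < 1 := by
      rw [norm_mul, RCLike.norm_conj]
      exact mul_lt_one_of_nonneg_of_lt_one_left (norm_nonneg _) (p.1.2 i) (p.2.2 i).le
    rw [h1] at h2
    simp at h2

/-- The kernel function depends norm-continuously on its point, since the norm of a difference is
expressed through the continuous Szegő kernel. -/
theorem continuous_coe_hardy (f : Hardy d) : Continuous f := by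
  have hk : Continuous fun z : polydisc d => RKHS.kerFun (Hardy d) z (1 : ℂ) := by
    refine continuous_iff_continuousAt.2 fun w => tendsto_iff_norm_sub_tendsto_zero.2 ?_
    have h : ∀ z : polydisc d, ‖RKHS.kerFun (Hardy d) z (1 : ℂ) - RKHS.kerFun (Hardy d) w (1 : ℂ)‖
        = √(szego d z z - szego d z w - szego d w z + szego d w w).re := fun z => by
      rw [← Real.sqrt_sq (norm_nonneg _), ← inner_self_eq_norm_sq (𝕜 := ℂ)]
      congr 1
      simp only [inner_sub_left, inner_sub_right, RKHS.kerFun_inner, kerFun_one_apply]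
      simp
      ring
    simp only [h]
    have hs := continuous_szego (d := d)
    have hc : Continuous fun z : polydisc d =>
        √(szego d z z - szego d z w - szego d w z + szego d w w).re :=
      Real.continuous_sqrt.comp (Complex.continuous_re.comp
        ((((hs.comp (continuous_id.prodMk continuous_id)).sub
          (hs.comp (continuous_id.prodMk continuous_const))).sub
          (hs.comp (continuous_const.prodMk continuous_id))).add continuous_const))
    simpa using hc.tendsto w
  have h : ∀ z, f z = inner ℂ (RKHS.kerFun (Hardy d) z (1 : ℂ)) f := fun z => by
    rw [RKHS.kerFun_inner]; simp
  rw [show (f : polydisc d → ℂ) = fun z => inner ℂ (RKHS.kerFun (Hardy d) z (1 : ℂ)) f from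
    funext h]
  exact hk.inner continuous_const

/-- Replacing a coordinate of a point of the polydisc. -/
def updateCoord (w : polydisc d) (i : Fin d) (t : ℂ) (ht : ‖t‖ < 1) : polydisc d :=
  ⟨Function.update w.1 i t, fun j => by
    rcases eq_or_ne j i with rfl | h
    · simpa using ht
    · simpa [h] using w.2 j⟩

/-- The hyperplane where coordinate `i` vanishes has dense complement. This permits division by that
coordinate in the backward shift. -/
theorem hardy_eq_zero_of_coord_ne_zero (i : Fin d) (f : Hardy d)
    (hf : ∀ w : polydisc d, w.1 i ≠ 0 → f w = 0) : f = 0 := by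
  refine RKHS.ext fun w => ?_
  rw [RKHS.coe_zero, Pi.zero_apply]
  by_cases hw : w.1 i = 0
  · have h2 : ‖(2⁻¹ : ℂ)‖ < 1 := by norm_num
    have ht : ∀ n : ℕ, ‖(2⁻¹ : ℂ) ^ (n + 1)‖ < 1 := fun n => by
      rw [norm_pow]
      exact pow_lt_one₀ (norm_nonneg _) h2 n.succ_ne_zero
    have h1 : Filter.Tendsto (fun n : ℕ => updateCoord w i _ (ht n)) Filter.atTop (nhds w) := by
      refine tendsto_subtype_rng.2 ?_
      have : Filter.Tendsto (fun n : ℕ => (2⁻¹ : ℂ) ^ (n + 1)) Filter.atTop (nhds (w.1 i)) := by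
        rw [hw]
        exact (tendsto_pow_atTop_nhds_zero_of_norm_lt_one h2).comp (Filter.tendsto_add_atTop_nat 1)
      have h := (tendsto_const_nhds (x := w.1)).update i this
      rw [Function.update_eq_self] at h
      exact h
    have h2 := ((continuous_coe_hardy f).tendsto w).comp h1
    refine tendsto_nhds_unique h2 (tendsto_const_nhds.congr fun n => (hf _ ?_).symm)
    simp [updateCoord]
  · exact hf w hw

/-- Kernel functions are eigenvectors of the backward shift f ↦ (f - f|_{w_i = 0}) / w_i, with
eigenvalue the conjugate of `z.1 i`; stated without the division. -/
theorem szego_sub_szego_update (w z : polydisc d) (i : Fin d) :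
    szego d w z - szego d (updateCoord w i 0 (by simp)) z
      = w.1 i * conj (z.1 i) * szego d w z := by
  have h0 : 1 - w.1 i * conj (z.1 i) ≠ 0 := fun h => by
    have h2 : ‖w.1 i * conj (z.1 i)‖ < 1 := by
      rw [norm_mul, RCLike.norm_conj]
      exact mul_lt_one_of_nonneg_of_lt_one_left (norm_nonneg _) (w.2 i) (z.2 i).le
    rw [← sub_eq_zero.1 h] at h2
    simp at h2
  have e : szego d (updateCoord w i 0 (by simp)) z
      = ∏ j ∈ Finset.univ.erase i, (1 - w.1 j * conj (z.1 j))⁻¹ := by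
    rw [szego, ← Finset.mul_prod_erase _ _ (Finset.mem_univ i)]
    simp only [updateCoord, Function.update_self, zero_mul, sub_zero, inv_one, one_mul]
    refine Finset.prod_congr rfl fun j hj => ?_
    rw [Function.update_of_ne (Finset.ne_of_mem_erase hj)]
  rw [e, szego, ← Finset.mul_prod_erase _ _ (Finset.mem_univ i)]
  field_simp
  ring

end Kernel

/-! ### Interpolation criterion and necessary separation -/

section Interpolation

variable {d : ℕ} {Z : ℕ → polydisc d} {T : Hardy d →L[ℂ] lp (fun _ : ℕ => ℂ) 2}

theorem hasSum_adjoint_apply (hT : ∀ f n, T f n = inner ℂ (unitKer (Z n)) f)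
    (c : lp (fun _ : ℕ => ℂ) 2) (w : polydisc d) :
    HasSum (fun n => c n * ((weight (Z n) : ℂ) * szego d w (Z n))) (T.adjoint c w) := by
  have h := (hasSum_adjoint_analysis hT c).mapL
    ((ContinuousLinearMap.proj w).comp (RKHS.coeCLM ℂ : Hardy d →L[ℂ] polydisc d → ℂ))
  simpa [unitKer_apply] using h

theorem exists_lp_mul (b : ℕ → ℂ) (hb : ∀ n, ‖b n‖ ≤ 1) (c : lp (fun _ : ℕ => ℂ) 2) :
    ∃ c' : lp (fun _ : ℕ => ℂ) 2, ∀ n, c' n = b n * c n := by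
  have hc := (lp.memℓp c).summable (by simp)
  refine ⟨⟨fun n => b n * c n, memℓp_gen (hc.of_nonneg_of_le (fun _ => by positivity) fun n => ?_)⟩,
    fun n => rfl⟩
  refine Real.rpow_le_rpow (norm_nonneg _) ?_ (by simp)
  rw [norm_mul]
  exact mul_le_of_le_one_left (norm_nonneg _) (hb n)

/-- The kernel of the synthesis operator is invariant under the coordinate shifts. -/
theorem exists_adjoint_eq_zero_mul (hT : ∀ f n, T f n = inner ℂ (unitKer (Z n)) f)
    {c : lp (fun _ : ℕ => ℂ) 2} (hc : T.adjoint c = 0) (i : Fin d) (a : ℂ) :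
    ∃ c' : lp (fun _ : ℕ => ℂ) 2, T.adjoint c' = 0 ∧
      ∀ n, c' n = (conj ((Z n).1 i) - a) * c n := by
  obtain ⟨b, hb⟩ := exists_lp_mul (fun n => conj ((Z n).1 i))
    (fun n => by rw [RCLike.norm_conj]; exact ((Z n).2 i).le) c
  refine ⟨b - a • c, ?_, fun n => ?_⟩
  · rw [map_sub, map_smul, hc, smul_zero, sub_zero]
    refine hardy_eq_zero_of_coord_ne_zero i _ fun w hw => ?_
    have h1 := hasSum_adjoint_apply hT c w
    have h2 := hasSum_adjoint_apply hT c (updateCoord w i 0 (by simp))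
    rw [hc, RKHS.coe_zero, Pi.zero_apply] at h1 h2
    -- Backward shift of the zero function, computed termwise: each term acquires its eigenvalue,
    -- giving the synthesis of `b`.
    have h3 := (h1.sub h2).mul_left (w.1 i)⁻¹
    refine (hasSum_adjoint_apply hT b w).unique ?_
    rw [sub_zero, mul_zero] at h3
    refine h3.congr_fun fun n => ?_
    rw [← mul_sub, ← mul_sub, szego_sub_szego_update, hb]
    field_simp
  · simp only [lp.coeFn_sub, lp.coeFn_smul, Pi.sub_apply, Pi.smul_apply, smul_eq_mul, hb]
    ring

/-- The points of `F` are removed one at a time. Multiplying entries by the conjugate of `(Z n).1 i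
- (Z j).1 i` keeps a kernel element in the kernel and kills its entry at `j`, so the product
vanishes by hypothesis. Distinctness gives every n ≠ j a coordinate with nonzero multiplier, so the
original element lives at `j` alone, where a single unit vector cannot synthesise to zero. -/
theorem eq_zero_of_adjoint_eq_zero (hT : ∀ f n, T f n = inner ℂ (unitKer (Z n)) f)
    (hZ : Function.Injective Z) (F : Finset ℕ)
    (hF : ∀ c, T.adjoint c = 0 → (∀ n ∈ F, c n = 0) → c = 0) :
    ∀ c, T.adjoint c = 0 → c = 0 := by
  induction F using Finset.induction_on with
  | empty => exact fun c hc => hF c hc (by simp)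
  | insert j F hj ih =>
    refine ih fun c hc hcF => ?_
    have h1 : ∀ n, n ≠ j → c n = 0 := by
      intro n hn
      have : ∃ i, (Z n).1 i ≠ (Z j).1 i := by
        by_contra! h
        exact hn (hZ (Subtype.ext (funext h)))
      obtain ⟨i, hi⟩ := this
      obtain ⟨c', hc', hcn⟩ := exists_adjoint_eq_zero_mul hT hc i (conj ((Z j).1 i))
      have h0 : c' = 0 := by
        refine hF c' hc' fun k hk => ?_
        rw [hcn]
        rcases Finset.mem_insert.1 hk with rfl | hk
        · simp
        · rw [hcF k hk, mul_zero]
      have h := hcn n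
      rw [h0] at h
      refine (mul_eq_zero.1 h.symm).resolve_left fun h' => hi ?_
      exact (starRingEnd ℂ).injective (sub_eq_zero.1 h')
    have h2 : T.adjoint c = c j • unitKer (Z j) :=
      (hasSum_adjoint_analysis hT c).unique (hasSum_single j fun n hn => by rw [h1 n hn, zero_smul])
    have h3 : c j = 0 := by
      rw [hc] at h2
      refine (smul_eq_zero.1 h2.symm).resolve_right fun h => ?_
      have := norm_unitKer (Z j)
      rw [h, norm_zero] at this
      exact zero_ne_one this
    ext n
    rcases eq_or_ne n j with rfl | h
    · exact h3
    · exact h1 n h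

/-- A sequence of distinct points whose normalised Gram matrix is a Hilbert–Schmidt perturbation of
the identity is interpolating. -/
theorem isInterpolating_of_summable (hZ : Function.Injective Z)
    (hu : Summable fun p => ‖gramDefect (fun n => unitKer (Z n)) p‖ ^ 2) : IsInterpolating Z := by
  obtain ⟨T, hT⟩ := exists_analysis _ hu
  obtain ⟨F, hF⟩ := exists_norm_le_adjoint_analysis hu hT
  refine ⟨T, fun f n => by rw [hT, inner_unitKer], surjective_of_injective_adjoint hu hT ?_⟩
  refine (injective_iff_map_eq_zero _).2 (eq_zero_of_adjoint_eq_zero hT hZ F fun c hc h => ?_)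
  have := hF c h
  rw [hc, norm_zero] at this
  refine norm_eq_zero.1 (pow_eq_zero_iff two_ne_zero |>.1 (le_antisymm ?_ (by positivity)))
  simpa using this

/-- By open mapping, some f with ‖f‖ ≤ C takes weighted value 1 at point n and 0 at point k. It
pairs to 1 with the component of the n-th unit vector orthogonal to the k-th, whose squared norm is
1 - |G_nk|²; this cannot be below 1 / C². -/
theorem IsInterpolating.exists_separation (h : IsInterpolating Z) :
    ∃ δ > 0, ∀ n k, n ≠ k → ‖inner ℂ (unitKer (Z n)) (unitKer (Z k))‖ ^ 2 ≤ 1 - δ := by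
  obtain ⟨T, hT, hs⟩ := h
  obtain ⟨C, hC, hpre⟩ := T.exists_preimage_norm_le hs
  refine ⟨1 / C ^ 2, by positivity, fun n k hnk => ?_⟩
  obtain ⟨f, hf, hfC⟩ := hpre (lp.single 2 n 1)
  have hfC' : ‖f‖ ≤ C := by simpa [lp.norm_single] using hfC
  set u := unitKer (Z n)
  set v := unitKer (Z k)
  have h1 : inner ℂ u f = 1 := by
    rw [inner_unitKer, ← hT, hf]; simp
  have h2 : inner ℂ v f = 0 := by
    rw [inner_unitKer, ← hT, hf]; simp [hnk.symm]
  set g := inner ℂ v u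
  have h3 : inner ℂ (u - g • v) f = 1 := by
    rw [inner_sub_left, inner_smul_left, h1, h2]; simp
  have h4 : ‖u - g • v‖ ^ 2 = 1 - ‖g‖ ^ 2 := by
    have hu := norm_unitKer (Z n)
    have hv := norm_unitKer (Z k)
    rw [@norm_sub_sq ℂ, hu, norm_smul, hv, inner_smul_right]
    have : g * inner ℂ u v = ((‖g‖ ^ 2 : ℝ) : ℂ) := by
      rw [← inner_conj_symm u v, Complex.mul_conj']
      push_cast; rfl
    rw [this, RCLike.re_eq_complex_re, Complex.ofReal_re]
    ring
  have h5 : 1 ≤ ‖u - g • v‖ * C := by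
    have h := norm_inner_le_norm (𝕜 := ℂ) (u - g • v) f
    rw [h3, norm_one] at h
    exact h.trans (by gcongr)
  have h6 : 1 ≤ (1 - ‖g‖ ^ 2) * C ^ 2 := by
    rw [← h4, ← mul_pow]
    exact one_le_pow₀ h5
  rw [norm_inner_symm]
  have : 1 / C ^ 2 ≤ 1 - ‖g‖ ^ 2 := by rwa [div_le_iff₀ (by positivity)]
  linarith

end Interpolation
-- The weighted Schur test over dyadic shells
section Sums

theorem tsum_pi_prod {d : ℕ} (f : Fin d → ℕ → ℝ≥0∞) :
    ∑' l : Fin d → ℕ, ∏ i, f i (l i) = ∏ i, ∑' b, f i b := by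
  induction d with
  | zero => simp
  | succ d ih =>
    rw [← (Fin.consEquiv fun _ : Fin (d + 1) => ℕ).tsum_eq, ENNReal.tsum_prod',
      Fin.prod_univ_succ, ← ih, ← ENNReal.tsum_mul_right]
    refine tsum_congr fun a => ?_
    rw [← ENNReal.tsum_mul_left]
    refine tsum_congr fun l => ?_
    simp [Fin.prod_univ_succ, Fin.consEquiv]

theorem tsum_comp_eq_tsum_encard {α β : Type*} (μ : α → β) (g : β → ℝ≥0∞) :
    ∑' n, g (μ n) = ∑' m, (({n | μ n = m}.encard : ℕ∞) : ℝ≥0∞) * g m := by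
  classical
  have h : ∀ n, g (μ n) = ∑' m, if μ n = m then g m else 0 := fun n => by
    rw [tsum_eq_single (μ n) fun m hm => if_neg hm.symm, if_pos rfl]
  simp_rw [h]
  rw [ENNReal.tsum_comm]
  refine tsum_congr fun m => ?_
  rw [← ENNReal.tsum_set_one, ← ENNReal.tsum_mul_right,
    tsum_subtype {n | μ n = m} fun _ => 1 * g m]
  refine tsum_congr fun n => ?_
  simp [Set.indicator_apply]

theorem ennreal_mul_le_weighted (u v t t' : ℝ≥0∞) (h : t * t' = 1) :
    u * v ≤ t * u ^ 2 + t' * v ^ 2 := by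
  rcases le_total v (t * u) with hv | hv
  · calc u * v ≤ u * (t * u) := by gcongr
      _ = t * u ^ 2 := by ring
      _ ≤ _ := le_self_add
  · calc u * v = (t * t') * u * v := by rw [h, one_mul]
      _ = t' * v * (t * u) := by ring
      _ ≤ t' * v * v := by gcongr
      _ = t' * v ^ 2 := by ring
      _ ≤ _ := le_add_self

/-- One coordinate of the weighted Schur kernel. -/
noncomputable def schurTerm (w : ℝ≥0∞) (a b : ℕ) : ℝ≥0∞ := 2⁻¹ ^ max a b * (w ^ b * w⁻¹ ^ a)

/-- Split at b = a: below, the terms decay like w^(-(a - b)); above, like (w / 2)^(b - a). Both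
geometric series converge when 1 < w < 2. -/
theorem tsum_schurTerm_le {w : ℝ≥0∞} (hw0 : w ≠ 0) (hw : w ≠ ∞) (a : ℕ) :
    ∑' b, schurTerm w a b ≤ 2⁻¹ ^ a * ((∑' k : ℕ, w⁻¹ ^ k) + ∑' k : ℕ, (2⁻¹ * w) ^ k) := by
  have hc : ∀ j : ℕ, w ^ j * w⁻¹ ^ j = 1 := fun j => by
    rw [← mul_pow, ENNReal.mul_inv_cancel hw0 hw, one_pow]
  rw [← Summable.sum_add_tsum_nat_add' (f := schurTerm w a) (k := a) ENNReal.summable, mul_add]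
  refine add_le_add ?_ ?_
  · calc ∑ b ∈ Finset.range a, schurTerm w a b
        = ∑ b ∈ Finset.range a, 2⁻¹ ^ a * w⁻¹ ^ (a - b) := by
          refine Finset.sum_congr rfl fun b hb => ?_
          have hb := (Finset.mem_range.1 hb).le
          obtain ⟨k, rfl⟩ := Nat.exists_eq_add_of_le hb
          rw [schurTerm, max_eq_left hb, pow_add w⁻¹, ← mul_assoc (w ^ b), hc, one_mul,
            Nat.add_sub_cancel_left]
      _ = 2⁻¹ ^ a * ∑ b ∈ Finset.range a, w⁻¹ ^ (b + 1) := by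
          rw [← Finset.mul_sum, ← Finset.sum_range_reflect (fun b => w⁻¹ ^ (b + 1))]
          refine congrArg _ (Finset.sum_congr rfl fun b hb => ?_)
          have hb := Finset.mem_range.1 hb
          rw [show a - 1 - b + 1 = a - b by omega]
      _ ≤ 2⁻¹ ^ a * ∑' b : ℕ, w⁻¹ ^ (b + 1) := by
          gcongr
          exact ENNReal.sum_le_tsum _
      _ ≤ 2⁻¹ ^ a * ∑' k : ℕ, w⁻¹ ^ k := by
          refine mul_le_mul_right ?_ _
          exact ENNReal.tsum_comp_le_tsum_of_injective (add_left_injective 1) fun k => w⁻¹ ^ k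
  · rw [← ENNReal.tsum_mul_left]
    refine ENNReal.tsum_le_tsum fun k => le_of_eq ?_
    rw [schurTerm, max_eq_right (Nat.le_add_left a k), mul_pow]
    calc 2⁻¹ ^ (k + a) * (w ^ (k + a) * w⁻¹ ^ a)
        = 2⁻¹ ^ a * (2⁻¹ ^ k * w ^ k) * (w ^ a * w⁻¹ ^ a) := by ring
      _ = _ := by rw [hc, mul_one]

variable {d : ℕ}

/-- The kernel `∏ i, 2 ^ (-max (m i) (l i))`. -/
noncomputable def maxKernel (m l : Fin d → ℕ) : ℝ≥0∞ := ∏ i, 2⁻¹ ^ max (m i) (l i)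

/-- Schur test with weights w^(l_i - m_i). Unweighted row sums of 2^(-max(a, b)) would be of order a
2^(-a), losing a factor a; the weights remove it. -/
theorem tsum_mul_mul_maxKernel_lt_top (N : (Fin d → ℕ) → ℝ≥0∞)
    (hN : ∑' m, N m ^ 2 * 2⁻¹ ^ ∑ i, m i < ∞) :
    ∑' m, ∑' l, N m * N l * maxKernel m l < ∞ := by
  -- Any value strictly between 1 and 2 would serve.
  set w : ℝ≥0∞ := 3 / 2 with hw
  have hw0 : w ≠ 0 := by simp [hw]
  have hwt : w ≠ ∞ := by simp [hw, ENNReal.div_eq_top]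
  set C : ℝ≥0∞ := (∑' k : ℕ, w⁻¹ ^ k) + ∑' k : ℕ, (2⁻¹ * w) ^ k with hC
  have hgeo : ∀ q : ℝ≥0∞, q < 1 → ∑' k : ℕ, q ^ k ≠ ∞ := fun q hq => by
    rw [ENNReal.tsum_geometric]
    exact ENNReal.inv_ne_top.2 (tsub_pos_of_lt hq).ne'
  have hCt : C ≠ ∞ := by
    refine ENNReal.add_ne_top.2 ⟨hgeo _ ?_, hgeo _ ?_⟩
    · rw [ENNReal.inv_lt_one, hw]
      rw [ENNReal.lt_div_iff_mul_lt (by simp) (by simp)]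
      norm_num
    · rw [mul_comm, ← div_eq_mul_inv, ENNReal.div_lt_iff (by simp) (by simp), hw,
        ENNReal.div_lt_iff (by simp) (by simp)]
      norm_num
  let t : (Fin d → ℕ) → (Fin d → ℕ) → ℝ≥0∞ := fun m l => ∏ i, w ^ l i * w⁻¹ ^ m i
  have ht : ∀ m l, t m l * t l m = 1 := fun m l => by
    rw [← Finset.prod_mul_distrib]
    refine Finset.prod_eq_one fun i _ => ?_
    have hc : ∀ j : ℕ, w ^ j * w⁻¹ ^ j = 1 := fun j => by
      rw [← mul_pow, ENNReal.mul_inv_cancel hw0 hwt, one_pow]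
    calc _ = (w ^ l i * w⁻¹ ^ l i) * (w ^ m i * w⁻¹ ^ m i) := by ring
      _ = 1 := by rw [hc, hc, one_mul]
  have hS : ∀ m, ∑' l, maxKernel m l * t m l ≤ C ^ d * 2⁻¹ ^ ∑ i, m i := fun m => by
    calc ∑' l, maxKernel m l * t m l = ∑' l : Fin d → ℕ, ∏ i, schurTerm w (m i) (l i) := by
          refine tsum_congr fun l => ?_
          rw [maxKernel, ← Finset.prod_mul_distrib]
          rfl
      _ = ∏ i, ∑' b, schurTerm w (m i) b := tsum_pi_prod _
      _ ≤ ∏ i, 2⁻¹ ^ m i * C := Finset.prod_le_prod' fun i _ => tsum_schurTerm_le hw0 hwt _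
      _ = _ := by
          rw [Finset.prod_mul_distrib, Finset.prod_pow_eq_pow_sum, Finset.prod_const,
            Finset.card_univ, Fintype.card_fin, mul_comm]
  have hsymm : ∀ m l : Fin d → ℕ, maxKernel m l = maxKernel l m := fun m l => by
    simp only [maxKernel, max_comm]
  have h1 : ∑' m, ∑' l, N m ^ 2 * (maxKernel m l * t m l) ≤
      C ^ d * ∑' m, N m ^ 2 * 2⁻¹ ^ ∑ i, m i := by
    rw [← ENNReal.tsum_mul_left]
    refine ENNReal.tsum_le_tsum fun m => ?_
    rw [ENNReal.tsum_mul_left]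
    calc _ ≤ N m ^ 2 * (C ^ d * 2⁻¹ ^ ∑ i, m i) := by gcongr; exact hS m
      _ = _ := by ring
  have h2 : ∑' m, ∑' l, N m * N l * maxKernel m l ≤
      ∑' m, ∑' l, (N m ^ 2 * (maxKernel m l * t m l) + N l ^ 2 * (maxKernel l m * t l m)) := by
    refine ENNReal.tsum_le_tsum fun m => ENNReal.tsum_le_tsum fun l => ?_
    calc _ ≤ (t m l * N m ^ 2 + t l m * N l ^ 2) * maxKernel m l := by
          gcongr; exact ennreal_mul_le_weighted _ _ _ _ (ht m l)
      _ = _ := by rw [hsymm l m]; ring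
  refine h2.trans_lt ?_
  simp_rw [ENNReal.tsum_add]
  rw [ENNReal.tsum_comm (f := fun m l => N l ^ 2 * (maxKernel l m * t l m))]
  have h3 : C ^ d * ∑' m, N m ^ 2 * 2⁻¹ ^ ∑ i, m i < ∞ :=
    ENNReal.mul_lt_top (ENNReal.pow_lt_top hCt.lt_top) hN
  exact ENNReal.add_lt_top.2 ⟨h1.trans_lt h3, h1.trans_lt h3⟩

/-- `μ` records the dyadic shells of the radii `r`. -/
def IsLevel (r : ℕ → Fin d → ℝ) (μ : ℕ → Fin d → ℕ) : Prop :=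
  ∀ n i, (2⁻¹ : ℝ) ^ (μ n i + 1) < 1 - r n i ∧ 1 - r n i ≤ (2⁻¹ : ℝ) ^ μ n i

theorem exists_isLevel (r : ℕ → Fin d → ℝ) (hr : ∀ n i, r n i ∈ Set.Ico (0 : ℝ) 1) :
    ∃ μ, IsLevel r μ := by
  have h : ∀ n i, ∃ a : ℕ, (2⁻¹ : ℝ) ^ (a + 1) < 1 - r n i ∧ 1 - r n i ≤ (2⁻¹ : ℝ) ^ a :=
    fun n i => exists_nat_pow_near_of_lt_one (by linarith [(hr n i).2]) (by linarith [(hr n i).1])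
      (by norm_num) (by norm_num)
  choose μ hμ using h
  exact ⟨μ, hμ⟩

theorem IsLevel.shellCount_eq {r : ℕ → Fin d → ℝ} {μ : ℕ → Fin d → ℕ} (hμ : IsLevel r μ)
    (m : Fin d → ℕ) : shellCount r m = {n | μ n = m}.encard := by
  rw [shellCount]
  congr 1
  ext n
  simp only [Set.mem_ofPred_eq]
  constructor
  · intro h
    funext i
    have h1 : (2⁻¹ : ℝ) ^ (μ n i + 1) < 2⁻¹ ^ m i := by linarith [(hμ n i).1, (h i).1]
    have h2 : (2⁻¹ : ℝ) ^ (m i + 1) < 2⁻¹ ^ μ n i := by linarith [(hμ n i).2, (h i).2]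
    rw [pow_lt_pow_iff_right_of_lt_one₀ (by norm_num) (by norm_num)] at h1 h2
    omega
  · rintro rfl i
    constructor <;> linarith [(hμ n i).1, (hμ n i).2]

theorem IsLevel.tsum_maxKernel_lt_top {r : ℕ → Fin d → ℝ} {μ : ℕ → Fin d → ℕ} (hμ : IsLevel r μ)
    (h : shellSum r < ∞) : ∑' p : ℕ × ℕ, maxKernel (μ p.1) (μ p.2) < ∞ := by
  have := tsum_mul_mul_maxKernel_lt_top (fun m => (shellCount r m : ℝ≥0∞)) h
  convert this using 1
  rw [ENNReal.tsum_prod', tsum_comp_eq_tsum_encard μ fun m => ∑' k, maxKernel m (μ k)]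
  refine tsum_congr fun m => ?_
  rw [tsum_comp_eq_tsum_encard μ fun l => maxKernel m l, ← ENNReal.tsum_mul_left]
  refine tsum_congr fun l => ?_
  rw [hμ.shellCount_eq, hμ.shellCount_eq, mul_assoc]

/-- The denominator is at least 1 - x² and at least 1 - y², so the quotient is at most either one;
then 1 - x² ≤ 2 (1 - x). -/
theorem gramFactor_le {x y : ℝ} (hx : x ∈ Set.Ico (0 : ℝ) 1) (hy : y ∈ Set.Ico (0 : ℝ) 1)
    {a b : ℕ} (ha : 1 - x ≤ (2⁻¹ : ℝ) ^ a) (hb : 1 - y ≤ (2⁻¹ : ℝ) ^ b) :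
    (1 - x ^ 2) * (1 - y ^ 2) / (1 - (x * y) ^ 2) ≤ 2 * (2⁻¹ : ℝ) ^ max a b := by
  obtain ⟨hx0, hx1⟩ := hx
  obtain ⟨hy0, hy1⟩ := hy
  have hx2 : x ^ 2 < 1 := by nlinarith
  have hy2 : y ^ 2 < 1 := by nlinarith
  have hxy : (x * y) ^ 2 < 1 := by rw [mul_pow]; nlinarith [sq_nonneg x, sq_nonneg y]
  have h1 : (1 - x ^ 2) * (1 - y ^ 2) / (1 - (x * y) ^ 2) ≤ 1 - x ^ 2 := by
    rw [div_le_iff₀ (by linarith)]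
    have : 1 - y ^ 2 ≤ 1 - (x * y) ^ 2 := by rw [mul_pow]; nlinarith [sq_nonneg y]
    exact mul_le_mul_of_nonneg_left this (by linarith)
  have h2 : (1 - x ^ 2) * (1 - y ^ 2) / (1 - (x * y) ^ 2) ≤ 1 - y ^ 2 := by
    rw [div_le_iff₀ (by linarith)]
    have : 1 - x ^ 2 ≤ 1 - (x * y) ^ 2 := by rw [mul_pow]; nlinarith [sq_nonneg x]
    nlinarith
  rcases le_total a b with hab | hab
  · rw [max_eq_right hab]; nlinarith
  · rw [max_eq_left hab]; nlinarith

end Sums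
-- Uniform angles and the mean squared Gram entry
section UniformLaw

/-- The uniform law on `(0, 2π)`. -/
noncomputable def angleLaw : Measure ℝ := ProbabilityTheory.cond volume (Set.Ioo (0 : ℝ) (2 * Real.pi))

theorem volume_angle : volume (Set.Ioo (0 : ℝ) (2 * Real.pi)) = ENNReal.ofReal (2 * Real.pi) := by
  rw [Real.volume_Ioo, sub_zero]

theorem volume_angle_ne_zero : volume (Set.Ioo (0 : ℝ) (2 * Real.pi)) ≠ 0 := by
  rw [volume_angle]
  simpa using Real.pi_pos

theorem volume_angle_ne_top : volume (Set.Ioo (0 : ℝ) (2 * Real.pi)) ≠ ∞ := by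
  rw [volume_angle]
  exact ENNReal.ofReal_ne_top

instance : IsProbabilityMeasure angleLaw :=
  cond_isProbabilityMeasure_of_finite volume_angle_ne_zero volume_angle_ne_top

theorem cond_pi_eq (d : ℕ) :
    ProbabilityTheory.cond (volume : Measure (Fin d → ℝ))
      (Set.univ.pi fun _ : Fin d => Set.Ioo (0 : ℝ) (2 * Real.pi)) =
    Measure.pi fun _ => angleLaw := by
  refine (Measure.pi_eq fun s hs => ?_).symm
  rw [cond_apply (MeasurableSet.univ_pi fun _ => measurableSet_Ioo), ← Set.pi_inter_distrib,
    volume_pi_pi, volume_pi_pi]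
  simp only [angleLaw]
  simp_rw [cond_apply (measurableSet_Ioo (a := (0 : ℝ)) (b := 2 * Real.pi))]
  rw [Finset.prod_mul_distrib, Finset.prod_const, Finset.prod_const, ENNReal.inv_pow]

theorem angleLaw_absolutelyContinuous : angleLaw ≪ volume := cond_absolutelyContinuous

theorem integral_angleLaw (f : ℝ → ℝ) :
    ∫ t, f t ∂angleLaw = (2 * Real.pi)⁻¹ * ∫ t in (0 : ℝ)..2 * Real.pi, f t := by
  rw [angleLaw, ProbabilityTheory.cond, integral_smul_measure, volume_angle, ENNReal.toReal_inv,
    ENNReal.toReal_ofReal Real.two_pi_pos.le, smul_eq_mul,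
    intervalIntegral.integral_of_le Real.two_pi_pos.le, integral_Ioc_eq_integral_Ioo]

/-- Up to a constant the integrand is the Poisson kernel of the disc at a = x y e^{is}, whose circle
average is 1. -/
theorem integral_gramFactor {x y : ℝ} (hx : x ∈ Set.Ico (0 : ℝ) 1) (hy : y ∈ Set.Ico (0 : ℝ) 1)
    (s : ℝ) :
    ∫ t, (1 - x ^ 2) * (1 - y ^ 2) /
        ‖1 - (x : ℂ) * exp (t * I) * conj ((y : ℂ) * exp (s * I))‖ ^ 2 ∂angleLaw =
      (1 - x ^ 2) * (1 - y ^ 2) / (1 - (x * y) ^ 2) := by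
  set a : ℂ := (x * y : ℝ) * exp (s * I) with ha
  have hna : ‖a‖ = x * y := by
    rw [ha, norm_mul, Complex.norm_exp_ofReal_mul_I, mul_one, Complex.norm_real, Real.norm_eq_abs,
      abs_of_nonneg (mul_nonneg hx.1 hy.1)]
  have hlt : x * y < 1 := mul_lt_one_of_nonneg_of_lt_one_left hx.1 hx.2 hy.2.le
  have hpos : 0 < 1 - (x * y) ^ 2 := by nlinarith [mul_nonneg hx.1 hy.1]
  have key := DiffContOnCl.circleAverage_poissonKernel_smul' (E := ℂ) (f := fun _ => 1) (c := 0)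
    (R := 1) (w := a) diffContOnCl_const (by simpa [hna] using hlt)
  have hn : ∀ t : ℝ, ‖1 - (x : ℂ) * exp (t * I) * conj ((y : ℂ) * exp (s * I))‖
      = ‖circleMap 0 1 t - a‖ := fun t => by
    have h1 : ‖1 - (x : ℂ) * exp (t * I) * conj ((y : ℂ) * exp (s * I))‖
        = ‖1 - conj ((x : ℂ) * exp (t * I) * conj ((y : ℂ) * exp (s * I)))‖ := by
      rw [← RCLike.norm_conj, map_sub, map_one]
    have h2 : exp (t * I) * conj (exp (t * I)) = 1 := by
      rw [Complex.mul_conj', Complex.norm_exp_ofReal_mul_I]; simp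
    have h3 : circleMap 0 1 t - a = exp (t * I) *
        (1 - conj ((x : ℂ) * exp (t * I) * conj ((y : ℂ) * exp (s * I)))) := by
      simp only [circleMap, map_mul, Complex.conj_conj, Complex.conj_ofReal, ha]
      push_cast
      linear_combination (x * y * exp (s * I)) * h2
    rw [h1, h3, norm_mul, Complex.norm_exp_ofReal_mul_I, one_mul]
  have key' : ∫ t, (1 - (x * y) ^ 2) / ‖circleMap 0 1 t - a‖ ^ 2 ∂angleLaw = 1 := by
    rw [integral_angleLaw, ← Complex.ofReal_inj, Complex.ofReal_one, ← key,
      Real.circleAverage_def]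
    simp only [sub_zero, norm_circleMap_zero, abs_one, one_pow, hna, Complex.real_smul, mul_one,
      intervalIntegral.integral_ofReal]
    push_cast
    rfl
  calc _ = ∫ t, (1 - x ^ 2) * (1 - y ^ 2) / (1 - (x * y) ^ 2) *
        ((1 - (x * y) ^ 2) / ‖circleMap 0 1 t - a‖ ^ 2) ∂angleLaw := by
        refine integral_congr_ae (Filter.Eventually.of_forall fun t => ?_)
        simp only [hn]
        rw [div_mul_div_comm, mul_comm ((1 - x ^ 2) * (1 - y ^ 2)), mul_div_mul_left _ _ hpos.ne']
    _ = _ := by rw [integral_const_mul, key', mul_one]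

variable {d : ℕ}

/-- The squared modulus of the normalised Gram entry of the points with radii `x`, `y` and angles
`p.1`, `p.2`. -/
noncomputable def gramSq (x y : Fin d → ℝ) (p : (Fin d → ℝ) × (Fin d → ℝ)) : ℝ :=
  ∏ i, (1 - x i ^ 2) * (1 - y i ^ 2) /
    ‖1 - (x i : ℂ) * exp (p.1 i * I) * conj ((y i : ℂ) * exp (p.2 i * I))‖ ^ 2

theorem measurable_gramSq (x y : Fin d → ℝ) : Measurable (gramSq x y) := by
  unfold gramSq
  refine Finset.measurable_prod _ fun i _ => measurable_const.div ?_
  refine Continuous.measurable ?_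
  fun_prop

theorem gramSq_nonneg {x y : Fin d → ℝ} (hx : ∀ i, x i ∈ Set.Ico (0 : ℝ) 1)
    (hy : ∀ i, y i ∈ Set.Ico (0 : ℝ) 1) (p : (Fin d → ℝ) × (Fin d → ℝ)) : 0 ≤ gramSq x y p := by
  refine Finset.prod_nonneg fun i _ => div_nonneg (mul_nonneg ?_ ?_) (by positivity)
  · nlinarith [(hx i).1, (hx i).2]
  · nlinarith [(hy i).1, (hy i).2]

theorem lintegral_gramSq {x y : Fin d → ℝ} (hx : ∀ i, x i ∈ Set.Ico (0 : ℝ) 1)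
    (hy : ∀ i, y i ∈ Set.Ico (0 : ℝ) 1) :
    ∫⁻ p, ENNReal.ofReal (gramSq x y p)
      ∂((Measure.pi fun _ : Fin d => angleLaw).prod (Measure.pi fun _ : Fin d => angleLaw)) =
    ENNReal.ofReal (∏ i, (1 - x i ^ 2) * (1 - y i ^ 2) / (1 - (x i * y i) ^ 2)) := by
  rw [lintegral_prod_symm _ (measurable_gramSq x y).ennreal_ofReal.aemeasurable]
  have h : ∀ φ : Fin d → ℝ, ∫⁻ θ, ENNReal.ofReal (gramSq x y (θ, φ))
      ∂(Measure.pi fun _ : Fin d => angleLaw) =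
      ENNReal.ofReal (∏ i, (1 - x i ^ 2) * (1 - y i ^ 2) / (1 - (x i * y i) ^ 2)) := fun φ => by
    have hint : ∫ θ, gramSq x y (θ, φ) ∂(Measure.pi fun _ : Fin d => angleLaw) =
        ∏ i, (1 - x i ^ 2) * (1 - y i ^ 2) / (1 - (x i * y i) ^ 2) := by
      have h := integral_fintype_prod_eq_prod (μ := fun _ : Fin d => angleLaw)
        fun (i : Fin d) (t : ℝ) => (1 - x i ^ 2) * (1 - y i ^ 2) /
          ‖1 - (x i : ℂ) * exp (t * I) * conj ((y i : ℂ) * exp (φ i * I))‖ ^ 2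
      simp only [integral_gramFactor (hx _) (hy _)] at h
      exact h
    rw [← hint]
    -- Integrability comes for free: a non-integrable function has Bochner integral 0, while this
    -- integral is a product of positive factors.
    refine (ofReal_integral_eq_lintegral_ofReal (.of_integral_ne_zero ?_)
      (Filter.Eventually.of_forall fun θ => gramSq_nonneg hx hy _)).symm
    rw [hint]
    refine Finset.prod_ne_zero_iff.2 fun i _ => ?_
    obtain ⟨hx0, hx1⟩ := hx i
    obtain ⟨hy0, hy1⟩ := hy i
    have hlt : x i * y i < 1 := mul_lt_one_of_nonneg_of_lt_one_left hx0 hx1 hy1.le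
    have h1 : 0 < 1 - x i ^ 2 := by nlinarith
    have h2 : 0 < 1 - y i ^ 2 := by nlinarith
    have h3 : 0 < 1 - (x i * y i) ^ 2 := by nlinarith [mul_nonneg hx0 hy0]
    positivity
  simp only [h, lintegral_const, measure_univ, mul_one]

end UniformLaw

/-! ### Almost sure interpolation in the convergent case -/

section AlmostSure

variable {d : ℕ} {Ω : Type*} {r : ℕ → Fin d → ℝ} {hr : ∀ n i, r n i ∈ Set.Ico (0 : ℝ) 1} {θ : ℕ → Ω → Fin d → ℝ}

theorem norm_randomSeq (ω : Ω) (n : ℕ) (i : Fin d) :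
    ‖(randomSeq r hr θ ω n).1 i‖ = r n i := by
  simp [randomSeq, Complex.norm_exp_ofReal_mul_I, abs_of_nonneg (hr n i).1]

theorem norm_inner_randomSeq_sq (ω : Ω) (n k : ℕ) :
    ‖inner ℂ (unitKer (randomSeq r hr θ ω n)) (unitKer (randomSeq r hr θ ω k))‖ ^ 2 =
      gramSq (r n) (r k) (θ n ω, θ k ω) := by
  rw [norm_inner_unitKer_sq]
  simp only [norm_randomSeq]
  rfl

variable [MeasurableSpace Ω] {P : Measure Ω} [IsProbabilityMeasure P]

theorem map_prodMk_eq (hθ : ∀ n, Measurable (θ n)) (hindep : iIndepFun θ P)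
    (hmap : ∀ n, P.map (θ n) = Measure.pi fun _ => angleLaw) {n k : ℕ} (hnk : n ≠ k) :
    P.map (fun ω => (θ n ω, θ k ω)) =
      (Measure.pi fun _ : Fin d => angleLaw).prod (Measure.pi fun _ : Fin d => angleLaw) := by
  rw [((hindep.indepFun hnk).map_prod_eq_prod_map_map (hθ n).aemeasurable (hθ k).aemeasurable),
    hmap, hmap]

theorem lintegral_norm_inner_sq_le (hθ : ∀ n, Measurable (θ n)) (hindep : iIndepFun θ P)
    (hmap : ∀ n, P.map (θ n) = Measure.pi fun _ => angleLaw) {μ : ℕ → Fin d → ℕ}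
    (hμ : IsLevel r μ) (p : ℕ × ℕ) :
    ∫⁻ ω, ENNReal.ofReal (‖gramDefect (fun n => unitKer (randomSeq r hr θ ω n)) p‖ ^ 2) ∂P ≤
      2 ^ d * maxKernel (μ p.1) (μ p.2) := by
  obtain ⟨n, k⟩ := p
  by_cases hnk : n = k
  · subst hnk
    simp [gramDefect, norm_unitKer]
  · simp only [gramDefect, hnk, if_false, sub_zero, norm_inner_randomSeq_sq]
    have h := lintegral_map (μ := P) (measurable_gramSq (r n) (r k)).ennreal_ofReal
      ((hθ n).prodMk (hθ k))
    rw [map_prodMk_eq hθ hindep hmap hnk, lintegral_gramSq (hr n) (hr k)] at h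
    rw [← h, ENNReal.ofReal_prod_of_nonneg]
    · have e : (2 : ℝ≥0∞) ^ d * maxKernel (μ n) (μ k)
          = ∏ i, ENNReal.ofReal (2 * (2⁻¹ : ℝ) ^ max (μ n i) (μ k i)) := by
        rw [maxKernel, ← Fin.prod_const, ← Finset.prod_mul_distrib]
        refine Finset.prod_congr rfl fun i _ => ?_
        rw [ENNReal.ofReal_mul (by norm_num), ENNReal.ofReal_pow (by norm_num),
          ENNReal.ofReal_inv_of_pos (by norm_num)]
        simp
      rw [e]
      exact Finset.prod_le_prod' fun i _ => ENNReal.ofReal_le_ofReal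
        (gramFactor_le (hr n i) (hr k i) (hμ n i).2 (hμ k i).2)
    · intro i _
      obtain ⟨hx0, hx1⟩ := hr n i
      obtain ⟨hy0, hy1⟩ := hr k i
      have hlt : r n i * r k i < 1 := mul_lt_one_of_nonneg_of_lt_one_left hx0 hx1 hy1.le
      exact div_nonneg (mul_nonneg (by nlinarith) (by nlinarith))
        (by nlinarith [mul_nonneg hx0 hy0])

theorem ae_summable_gramDefect (hθ : ∀ n, Measurable (θ n)) (hindep : iIndepFun θ P)
    (hmap : ∀ n, P.map (θ n) = Measure.pi fun _ => angleLaw) (hsum : shellSum r < ∞) :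
    ∀ᵐ ω ∂P, Summable fun p =>
      ‖gramDefect (fun n => unitKer (randomSeq r hr θ ω n)) p‖ ^ 2 := by
  obtain ⟨μ, hμ⟩ := exists_isLevel r hr
  set f : ℕ × ℕ → Ω → ℝ≥0∞ := fun p ω =>
    ENNReal.ofReal (‖gramDefect (fun n => unitKer (randomSeq r hr θ ω n)) p‖ ^ 2) with hf
  have hm : ∀ p, Measurable (f p) := by
    rintro ⟨n, k⟩
    by_cases hnk : n = k
    · subst hnk
      simp [hf, gramDefect, norm_unitKer]
    · simp only [hf, gramDefect, hnk, if_false, sub_zero, norm_inner_randomSeq_sq]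
      exact ((measurable_gramSq (r n) (r k)).comp ((hθ n).prodMk (hθ k))).ennreal_ofReal
  have h1 : ∫⁻ ω, ∑' p, f p ω ∂P ≠ ∞ := by
    rw [lintegral_tsum fun p => (hm p).aemeasurable]
    refine ((ENNReal.tsum_le_tsum fun p =>
      lintegral_norm_inner_sq_le hθ hindep hmap hμ p).trans_lt ?_).ne
    rw [ENNReal.tsum_mul_left]
    exact ENNReal.mul_lt_top (by simp) (hμ.tsum_maxKernel_lt_top hsum)
  filter_upwards [ae_lt_top (Measurable.tsum hm) h1] with ω hω
  have h := ENNReal.summable_toReal hω.ne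
  refine h.congr fun p => ?_
  rw [hf, ENNReal.toReal_ofReal (by positivity)]

theorem ae_angle_sub_ne (hθ : ∀ n, Measurable (θ n)) (hindep : iIndepFun θ P)
    (hmap : ∀ n, P.map (θ n) = Measure.pi fun _ => angleLaw) {n k : ℕ} (hnk : n ≠ k) (i : Fin d)
    (c : ℝ) : ∀ᵐ ω ∂P, θ n ω i ≠ θ k ω i + c := by
  have hs : MeasurableSet {p : (Fin d → ℝ) × (Fin d → ℝ) | p.1 i = p.2 i + c} :=
    measurableSet_eq_fun (by fun_prop) (by fun_prop)
  have h0 : ((Measure.pi fun _ : Fin d => angleLaw).prod (Measure.pi fun _ : Fin d => angleLaw))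
      {p | p.1 i = p.2 i + c} = 0 := by
    refine (Measure.measure_prod_null hs).2 (Filter.Eventually.of_forall fun φ => ?_)
    have hn : NullSingletonClass angleLaw :=
      ⟨fun x => angleLaw_absolutelyContinuous (measure_singleton x)⟩
    refine measure_mono_null ?_ (Measure.pi_hyperplane (fun _ : Fin d => angleLaw) i (φ i - c))
    intro ψ hψ
    have : φ i = ψ i + c := hψ
    exact eq_sub_of_add_eq this.symm
  rw [← map_prodMk_eq hθ hindep hmap hnk, Measure.map_apply ((hθ n).prodMk (hθ k)) hs] at h0
  exact measure_eq_zero_iff_ae_notMem.1 h0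

/-- Coinciding points have equal radii, and some radius is nonzero by `h0`; there the angles differ
by an integer multiple of 2π, which is a countable union of null events. -/
theorem ae_injective_randomSeq (hθ : ∀ n, Measurable (θ n)) (hindep : iIndepFun θ P)
    (hmap : ∀ n, P.map (θ n) = Measure.pi fun _ => angleLaw)
    (h0 : ∀ n k, r n = 0 → r k = 0 → n = k) :
    ∀ᵐ ω ∂P, Function.Injective (randomSeq r hr θ ω) := by
  have h : ∀ᵐ ω ∂P, ∀ n k : ℕ, n ≠ k → ∀ (i : Fin d) (m : ℤ),
      θ n ω i ≠ θ k ω i + m * (2 * Real.pi) := by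
    simp only [ae_all_iff]
    exact fun n k hnk i m => ae_angle_sub_ne hθ hindep hmap hnk i _
  filter_upwards [h] with ω hω n k hnk
  by_contra hne
  have hrr : r n = r k := funext fun i => by
    rw [← norm_randomSeq (hr := hr) (θ := θ) ω n i, hnk, norm_randomSeq]
  have : ∃ i, r n i ≠ 0 := by
    by_contra! hz
    exact hne (h0 n k (funext hz) (hrr ▸ funext hz))
  obtain ⟨i, hi⟩ := this
  have he : (r n i : ℂ) * exp (θ n ω i * I) = (r k i : ℂ) * exp (θ k ω i * I) :=
    congrFun (congrArg Subtype.val hnk) i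
  rw [← hrr] at he
  have he' := mul_left_cancel₀ (Complex.ofReal_ne_zero.2 hi) he
  obtain ⟨m, hm⟩ := Complex.exp_eq_exp_iff_exists_int.1 he'
  refine hω n k hne i m ?_
  have h2 : (θ n ω i : ℂ) * I = ((θ k ω i + m * (2 * Real.pi) : ℝ) : ℂ) * I := by
    rw [hm]; push_cast; ring
  exact_mod_cast mul_right_cancel₀ Complex.I_ne_zero h2

theorem ae_isInterpolating (hθ : ∀ n, Measurable (θ n)) (hindep : iIndepFun θ P)
    (hmap : ∀ n, P.map (θ n) = Measure.pi fun _ => angleLaw) (hsum : shellSum r < ∞)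
    (h0 : ∀ n k, r n = 0 → r k = 0 → n = k) :
    ∀ᵐ ω ∂P, IsInterpolating (randomSeq r hr θ ω) := by
  filter_upwards [ae_injective_randomSeq (hr := hr) hθ hindep hmap h0,
    ae_summable_gramDefect (hr := hr) hθ hindep hmap hsum] with ω h1 h2
  exact isInterpolating_of_summable h1 h2

end AlmostSure
-- A birthday argument for independent, non-identically distributed variables
section Birthday

variable {Ω α γ : Type*}

/-- The number of earlier indices in the class of `n`. -/
def earlierCount [DecidableEq γ] (c : ℕ → γ) (n : ℕ) : ℕ := ((Finset.range n).filter fun k => c k = c n).card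

/-- The event that the first `n` variables do not collide within a class. -/
def noCollision (X : ℕ → Ω → α) (c : ℕ → γ) (n : ℕ) : Set Ω :=
  {ω | ∀ k < n, ∀ l < k, c l = c k → X l ω ≠ X k ω}

variable [MeasurableSpace Ω] {P : Measure Ω} [IsProbabilityMeasure P]
  [MeasurableSpace α] [Countable α] [MeasurableSingletonClass α]

theorem measurableSet_noCollision {X : ℕ → Ω → α} (hX : ∀ n, Measurable (X n)) (c : ℕ → γ)
    (n : ℕ) : MeasurableSet (noCollision X c n) := by
  have : noCollision X c n = ⋂ k, ⋂ (_ : k < n), ⋂ l, ⋂ (_ : l < k), ⋂ (_ : c l = c k),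
      {ω | X l ω = X k ω}ᶜ := by
    ext ω; simp [noCollision]
  rw [this]
  refine .iInter fun k => .iInter fun _ => .iInter fun l => .iInter fun _ => .iInter fun _ => ?_
  exact (measurableSet_eq_fun (hX l) (hX k)).compl

/-- The event depends only on the variables before `n`, which are independent of `X n`. Freezing
them by Fubini, `X n` hits the value of `X k` with probability at least `p`. -/
theorem mul_measure_noCollision_le {X : ℕ → Ω → α} (hX : ∀ n, Measurable (X n))
    (hind : iIndepFun X P) (c : ℕ → γ) {n k : ℕ} (hk : k < n) {p : ℝ≥0∞}
    (hp : ∀ᵐ ω ∂P, p ≤ P (X n ⁻¹' {X k ω})) :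
    p * P (noCollision X c n) ≤ P (noCollision X c n ∩ {ω | X k ω = X n ω}) := by
  let W : Ω → (Finset.range n → α) := fun ω i => X i ω
  have hW : Measurable W := measurable_pi_iff.2 fun i => hX i
  have hWX : IndepFun W (X n) P := by
    have h := hind.indepFun_finset (Finset.range n) {n} (by simp) hX
    exact h.comp (φ := id) (ψ := fun w : (({n} : Finset ℕ) → α) => w ⟨n, by simp⟩) measurable_id
      (measurable_pi_apply _)
  let B : Set (Finset.range n → α) :=
    {w | ∀ i j : Finset.range n, j.1 < i.1 → c j = c i → w j ≠ w i}
  have hB : noCollision X c n = W ⁻¹' B := by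
    ext ω
    constructor
    · exact fun h i j hji hc => h i (Finset.mem_range.1 i.2) j hji hc
    · exact fun h i hi j hj hc => h ⟨i, Finset.mem_range.2 hi⟩
        ⟨j, Finset.mem_range.2 (hj.trans hi)⟩ hj hc
  let k' : Finset.range n := ⟨k, Finset.mem_range.2 hk⟩
  let D : Set ((Finset.range n → α) × α) := {q | q.1 ∈ B ∧ q.1 k' = q.2}
  have hDm : MeasurableSet D := MeasurableSet.of_discrete
  have hD : noCollision X c n ∩ {ω | X k ω = X n ω} = (fun ω => (W ω, X n ω)) ⁻¹' D := by
    rw [hB]; rfl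
  rw [hD, ← Measure.map_apply (hW.prodMk (hX n)) hDm,
    hWX.map_prod_eq_prod_map_map hW.aemeasurable (hX n).aemeasurable, Measure.prod_apply hDm,
    lintegral_map (measurable_measure_prodMk_left hDm) hW]
  have hm := measurableSet_noCollision hX c n
  rw [← lintegral_indicator_const hm]
  refine lintegral_mono_ae ?_
  filter_upwards [hp] with ω hω
  by_cases h : ω ∈ noCollision X c n
  · rw [Set.indicator_of_mem h]
    refine hω.trans ?_
    rw [Measure.map_apply (hX n) (measurable_prodMk_left hDm)]
    refine measure_mono fun ω' h' => ?_
    rw [hB] at h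
    exact ⟨h, (Set.mem_singleton_iff.1 h').symm⟩
  · rw [Set.indicator_of_notMem h]
    exact zero_le

/-- Without an earlier collision, the predecessors of `n` in its class take distinct values, so the
events that `X n` hits one of them are disjoint and their probabilities add up. -/
theorem mul_add_measure_noCollision_succ_le [DecidableEq γ] {X : ℕ → Ω → α} (hX : ∀ n, Measurable (X n))
    (hind : iIndepFun X P) (c : ℕ → γ) (n : ℕ) {p : ℝ≥0∞}
    (hp : ∀ k < n, c k = c n → ∀ᵐ ω ∂P, p ≤ P (X n ⁻¹' {X k ω})) :
    earlierCount c n * p * P (noCollision X c n) + P (noCollision X c (n + 1)) ≤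
      P (noCollision X c n) := by
  set K := (Finset.range n).filter fun k => c k = c n with hK
  set U := ⋃ k ∈ K, noCollision X c n ∩ {ω | X k ω = X n ω} with hU
  have hmem : ∀ {k}, k ∈ K ↔ k < n ∧ c k = c n := by simp [hK]
  have hmeas : ∀ k ∈ K, MeasurableSet (noCollision X c n ∩ {ω | X k ω = X n ω}) := fun k _ =>
    (measurableSet_noCollision hX c n).inter (measurableSet_eq_fun (hX k) (hX n))
  have h1 : P U = ∑ k ∈ K, P (noCollision X c n ∩ {ω | X k ω = X n ω}) := by
    refine measure_biUnion_finset ?_ hmeas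
    intro k hk l hl hkl
    rw [Function.onFun, Set.disjoint_left]
    rintro ω ⟨h, h1⟩ ⟨-, h2⟩
    have hk := hmem.1 (Finset.mem_coe.1 hk)
    have hl := hmem.1 (Finset.mem_coe.1 hl)
    have e : X k ω = X l ω := Eq.trans h1 (Eq.symm h2)
    rcases lt_or_gt_of_ne hkl with hlt | hlt
    · exact h l hl.1 k hlt (hk.2.trans hl.2.symm) e
    · exact h k hk.1 l hlt (hl.2.trans hk.2.symm) e.symm
  have h2 : earlierCount c n * p * P (noCollision X c n) ≤ P U := by
    rw [h1, mul_assoc, earlierCount, ← nsmul_eq_mul]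
    refine Finset.card_nsmul_le_sum _ _ _ fun k hk => ?_
    have hk := hmem.1 hk
    exact mul_measure_noCollision_le hX hind c hk.1 (hp k hk.1 hk.2)
  have hdis : Disjoint U (noCollision X c (n + 1)) := by
    rw [Set.disjoint_left]
    intro ω hω h
    obtain ⟨k, hk, -, hkn⟩ := Set.mem_iUnion₂.1 hω
    have hk := hmem.1 hk
    exact h n n.lt_succ_self k hk.1 hk.2 hkn
  calc _ ≤ P U + P (noCollision X c (n + 1)) := by gcongr
    _ = P (U ∪ noCollision X c (n + 1)) :=
        (measure_union hdis (measurableSet_noCollision hX c _)).symm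
    _ ≤ _ := by
        refine measure_mono (Set.union_subset (Set.iUnion₂_subset fun _ _ => Set.inter_subset_left)
          fun ω h k hk => h k (hk.trans n.lt_succ_self))

/-- If the collision probabilities add up to infinity, then a collision occurs almost surely. -/
theorem ae_exists_collision [DecidableEq γ] {X : ℕ → Ω → α} (hX : ∀ n, Measurable (X n))
    (hind : iIndepFun X P) (c : ℕ → γ) {p : ℕ → ℝ≥0∞}
    (hp : ∀ n k, c k = c n → ∀ᵐ ω ∂P, p n ≤ P (X n ⁻¹' {X k ω}))
    (hsum : ∑' n, earlierCount c n * p n = ∞) :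
    ∀ᵐ ω ∂P, ∃ n k, k ≠ n ∧ c k = c n ∧ X k ω = X n ω := by
  set A : Set Ω := ⋂ n, noCollision X c n
  -- Telescoping the one-step losses, with each P(no collision so far) bounded below by P(A): a
  -- positive P(A) would make the series finite.
  have h1 : ∀ L, (∑ n ∈ Finset.range L, earlierCount c n * p n) * P A +
      P (noCollision X c L) ≤ 1 := by
    intro L
    induction L with
    | zero => simpa using prob_le_one
    | succ L ih =>
      refine le_trans ?_ ih
      rw [Finset.sum_range_succ, add_mul, add_assoc]
      gcongr
      refine le_trans ?_ (mul_add_measure_noCollision_succ_le hX hind c L fun k _ hk => hp L k hk)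
      gcongr
      exact Set.iInter_subset _ _
  have hA : P A = 0 := by
    by_contra h0
    have h2 : (∑' n, earlierCount c n * p n) ≤ (P A)⁻¹ := by
      refine ENNReal.tsum_le_of_sum_range_le fun L => ?_
      rw [ENNReal.le_inv_iff_mul_le]
      exact le_self_add.trans (h1 L)
    rw [hsum, top_le_iff, ENNReal.inv_eq_top] at h2
    exact h0 h2
  filter_upwards [measure_eq_zero_iff_ae_notMem.1 hA] with ω hω
  simp only [A, noCollision, Set.mem_iInter, Set.mem_ofPred_eq] at hω
  push Not at hω
  obtain ⟨-, k, -, l, hl, hc, hX⟩ := hω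
  exact ⟨k, l, hl.ne, hc, hX⟩

end Birthday

/-! ### Counting pairs within classes -/

section Pairs

variable {γ : Type*} [DecidableEq γ]

/-- A new member of a class of size N adds 2N + 1 on the left and 4N on the right. This suffices for
N ≥ 1, and the final + 1 pays for the first member. -/
theorem card_sq_le_sum_earlierCount (c : ℕ → γ) (g : γ) (L : ℕ) :
    ((Finset.range L).filter fun n => c n = g).card ^ 2 ≤
      4 * (∑ n ∈ (Finset.range L).filter fun n => c n = g, earlierCount c n) + 1 := by
  induction L with
  | zero => simp
  | succ L ih =>
    rw [Finset.range_add_one, Finset.filter_insert]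
    by_cases h : c L = g
    · have hn : L ∉ (Finset.range L).filter fun n => c n = g := by simp
      rw [if_pos h, Finset.card_insert_of_notMem hn, Finset.sum_insert hn, earlierCount, h]
      set N := ((Finset.range L).filter fun n => c n = g).card
      rcases Nat.eq_zero_or_pos N with h0 | h0
      · rw [h0]; omega
      · nlinarith
    · rw [if_neg h]; exact ih

theorem tsum_class_sq_le (c : ℕ → γ) (g : γ) :
    (∑' n, if c n = g then (1 : ℝ≥0∞) else 0) ^ 2 ≤
      4 * (∑' n, if c n = g then (earlierCount c n : ℝ≥0∞) else 0) + 1 := by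
  have h := (ENNReal.continuous_pow 2).tendsto _ |>.comp
    (ENNReal.tendsto_nat_tsum fun n => if c n = g then (1 : ℝ≥0∞) else 0)
  refine le_of_tendsto' h fun L => ?_
  have h1 := card_sq_le_sum_earlierCount c g L
  have h2 : ∑ n ∈ Finset.range L, (if c n = g then (earlierCount c n : ℝ≥0∞) else 0) ≤
      ∑' n, if c n = g then (earlierCount c n : ℝ≥0∞) else 0 := ENNReal.sum_le_tsum _
  refine le_trans ?_ (add_le_add_left (mul_le_mul_right h2 4) 1)
  rw [Function.comp_apply, ← Finset.sum_filter, ← Finset.sum_filter, Finset.sum_const,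
    nsmul_eq_mul, mul_one]
  exact_mod_cast h1

theorem tsum_eq_tsum_fiber {β : Type*} [DecidableEq β] (c : ℕ → β) (f : ℕ → ℝ≥0∞) :
    ∑' n, f n = ∑' b, ∑' n, if c n = b then f n else 0 := by
  rw [ENNReal.tsum_comm]
  refine tsum_congr fun n => ?_
  rw [tsum_eq_single (c n) fun b hb => if_neg hb.symm, if_pos rfl]

theorem ennreal_sum_sq_le {ι : Type*} [Fintype ι] (f : ι → ℝ≥0∞) :
    (∑ i, f i) ^ 2 ≤ 2 * Fintype.card ι * ∑ i, f i ^ 2 := by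
  rw [sq, Finset.sum_mul_sum]
  calc ∑ i, ∑ j, f i * f j ≤ ∑ i, ∑ j, (1 * f i ^ 2 + 1 * f j ^ 2) := by
        gcongr with i _ j _
        exact ennreal_mul_le_weighted _ _ 1 1 (by simp)
    _ = _ := by
        simp only [one_mul, Finset.sum_add_distrib, Finset.sum_const, Finset.card_univ,
          nsmul_eq_mul]
        rw [← Finset.mul_sum]
        ring

variable {d : ℕ} {r : ℕ → Fin d → ℝ} {μ : ℕ → Fin d → ℕ}

/-- Splitting shells into boundedly many classes and passing from squares to pairs costs constant
factors and an additive multiple of ∑ 2^(-|m|), which is finite; divergence survives. -/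
theorem IsLevel.tsum_earlierCount_eq_top {ι : Type*} [Fintype ι] [DecidableEq ι]
    (hμ : IsLevel r μ) (h : shellSum r = ∞) (q : ℕ → ι) :
    ∑' n, (earlierCount (fun n => (μ n, q n)) n : ℝ≥0∞) * 2⁻¹ ^ ∑ i, μ n i = ∞ := by
  set c : ℕ → (Fin d → ℕ) × ι := fun n => (μ n, q n) with hc
  set K : ℝ≥0∞ := ((Fintype.card ι : ℕ) : ℝ≥0∞) with hK
  have hKt : K ≠ ∞ := ENNReal.natCast_ne_top _
  by_contra hfin
  have hN : ∀ m, (shellCount r m : ℝ≥0∞) ^ 2 ≤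
      2 * K * ∑ a, (4 * (∑' n, if c n = (m, a) then (earlierCount c n : ℝ≥0∞) else 0) + 1) := by
    intro m
    have e : (shellCount r m : ℝ≥0∞) = ∑ a, ∑' n, if c n = (m, a) then (1 : ℝ≥0∞) else 0 := by
      rw [hμ.shellCount_eq, ← ENNReal.tsum_set_one, tsum_subtype {n | μ n = m} fun _ => (1 : ℝ≥0∞),
        ← tsum_fintype (L := .unconditional _), ENNReal.tsum_comm]
      refine tsum_congr fun n => ?_
      rw [tsum_fintype]
      by_cases hn : μ n = m <;> simp [hc, Prod.ext_iff, hn]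
    rw [e]
    refine (ennreal_sum_sq_le _).trans ?_
    gcongr with a
    exact tsum_class_sq_le c (m, a)
  have hS : shellSum r ≤ 2 * K * (4 * (∑' n, (earlierCount c n : ℝ≥0∞) * 2⁻¹ ^ ∑ i, μ n i) +
      K * ∑' m : Fin d → ℕ, 2⁻¹ ^ ∑ i, m i) := by
    have e1 : ∑' n, (earlierCount c n : ℝ≥0∞) * 2⁻¹ ^ ∑ i, μ n i =
        ∑' m : Fin d → ℕ, (∑ a, ∑' n, if c n = (m, a) then (earlierCount c n : ℝ≥0∞) else 0) *
          2⁻¹ ^ ∑ i, m i := by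
      rw [tsum_eq_tsum_fiber c, ENNReal.tsum_prod']
      refine tsum_congr fun m => ?_
      rw [tsum_fintype, Finset.sum_mul]
      refine Finset.sum_congr rfl fun a _ => ?_
      rw [← ENNReal.tsum_mul_right]
      refine tsum_congr fun n => ?_
      split_ifs with hn
      · rw [show μ n = m from congrArg Prod.fst hn]
      · rw [zero_mul]
    rw [e1, shellSum, ← ENNReal.tsum_mul_left, ← ENNReal.tsum_mul_left, ← ENNReal.tsum_add,
      ← ENNReal.tsum_mul_left]
    refine ENNReal.tsum_le_tsum fun m => ?_
    calc _ ≤ _ := mul_le_mul_left (hN m) _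
      _ = _ := by
        rw [Finset.sum_add_distrib, ← Finset.mul_sum, Finset.sum_const, Finset.card_univ,
          nsmul_eq_mul]
        ring
  have hgeo : ∑' m : Fin d → ℕ, (2⁻¹ : ℝ≥0∞) ^ ∑ i, m i ≠ ∞ := by
    simp_rw [← Finset.prod_pow_eq_pow_sum]
    rw [tsum_pi_prod fun _ b => (2⁻¹ : ℝ≥0∞) ^ b, Finset.prod_const, ENNReal.tsum_geometric]
    simp
  rw [h, top_le_iff] at hS
  exact ENNReal.mul_ne_top (ENNReal.mul_ne_top (by simp) hKt) (ENNReal.add_ne_top.2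
    ⟨ENNReal.mul_ne_top (by simp) hfin, ENNReal.mul_ne_top hKt hgeo⟩) hS

end Pairs
-- Small boxes and nearby points
section Boxes

variable {d : ℕ}

/-- The index of the box of side `2π / D i` that contains the angle vector `φ`. -/
noncomputable def boxIndex (D : Fin d → ℕ) (φ : Fin d → ℝ) (i : Fin d) : ℕ :=
  ⌊φ i * D i / (2 * Real.pi)⌋₊

theorem measurable_boxIndex (D : Fin d → ℕ) : Measurable (boxIndex D) := by
  refine measurable_pi_iff.2 fun i => Nat.measurable_floor.comp ?_
  fun_prop

theorem le_angleLaw_Ioo {D b : ℕ} (hb : b < D) :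
    (D : ℝ≥0∞)⁻¹ ≤ angleLaw (Set.Ioo (b * (2 * Real.pi / D)) ((b + 1) * (2 * Real.pi / D))) := by
  have hD : (0 : ℝ) < D := by exact_mod_cast (Nat.zero_le b).trans_lt hb
  have hpi := Real.two_pi_pos
  have hsub : Set.Ioo (b * (2 * Real.pi / D)) ((b + 1) * (2 * Real.pi / D)) ⊆
      Set.Ioo (0 : ℝ) (2 * Real.pi) := by
    refine Set.Ioo_subset_Ioo (by positivity) ?_
    have : (b + 1 : ℝ) ≤ D := by exact_mod_cast hb
    calc (b + 1) * (2 * Real.pi / D) ≤ D * (2 * Real.pi / D) := by gcongr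
      _ = 2 * Real.pi := by field_simp
  rw [angleLaw, cond_apply measurableSet_Ioo, Set.inter_eq_self_of_subset_right hsub, volume_angle,
    Real.volume_Ioo, ← ENNReal.ofReal_inv_of_pos hpi, ← ENNReal.ofReal_mul (by positivity),
    ← ENNReal.ofReal_natCast, ← ENNReal.ofReal_inv_of_pos hD]
  refine ENNReal.ofReal_le_ofReal (le_of_eq ?_)
  field_simp
  ring

theorem le_pi_angleLaw_boxIndex (D : Fin d → ℕ) {b : Fin d → ℕ} (hb : ∀ i, b i < D i) :
    ∏ i, (D i : ℝ≥0∞)⁻¹ ≤ (Measure.pi fun _ => angleLaw) (boxIndex D ⁻¹' {b}) := by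
  calc ∏ i, (D i : ℝ≥0∞)⁻¹ ≤ ∏ i, angleLaw
        (Set.Ioo (b i * (2 * Real.pi / D i)) ((b i + 1) * (2 * Real.pi / D i))) :=
        Finset.prod_le_prod' fun i _ => le_angleLaw_Ioo (hb i)
    _ = (Measure.pi fun _ => angleLaw) (Set.univ.pi fun i =>
        Set.Ioo (b i * (2 * Real.pi / D i)) ((b i + 1) * (2 * Real.pi / D i))) :=
        (Measure.pi_pi _ _).symm
    _ ≤ _ := by
        refine measure_mono fun φ hφ => funext fun i => ?_
        have hD : (0 : ℝ) < D i := by exact_mod_cast (Nat.zero_le (b i)).trans_lt (hb i)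
        have hpi := Real.two_pi_pos
        obtain ⟨h1, h2⟩ := hφ i trivial
        have h1' : (b i : ℝ) ≤ φ i * D i / (2 * Real.pi) := by
          rw [le_div_iff₀ hpi]
          calc b i * (2 * Real.pi) = b i * (2 * Real.pi / D i) * D i := by field_simp
            _ ≤ φ i * D i := by gcongr
        have h2' : φ i * D i / (2 * Real.pi) < b i + 1 := by
          rw [div_lt_iff₀ hpi]
          calc φ i * D i < (b i + 1) * (2 * Real.pi / D i) * D i := by gcongr
            _ = (b i + 1) * (2 * Real.pi) := by field_simp
        rw [boxIndex, Nat.floor_eq_iff (by linarith [(Nat.cast_nonneg (b i) : (0 : ℝ) ≤ b i)])]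
        exact ⟨h1', h2'⟩

theorem boxIndex_lt {D : Fin d → ℕ} (hD : ∀ i, 0 < D i) {φ : Fin d → ℝ}
    (hφ : ∀ i, φ i ∈ Set.Ioo (0 : ℝ) (2 * Real.pi)) (i : Fin d) : boxIndex D φ i < D i := by
  have hpi := Real.two_pi_pos
  have hD' : (0 : ℝ) < D i := by exact_mod_cast hD i
  rw [boxIndex, Nat.floor_lt' (hD i).ne', div_lt_iff₀ hpi, mul_comm]
  exact mul_lt_mul_of_pos_left (hφ i).2 hD'

theorem abs_sub_le_of_floor_eq {x y s : ℝ} (hs : 0 < s) (hx : 0 ≤ x) (hy : 0 ≤ y)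
    (h : ⌊x * s⌋₊ = ⌊y * s⌋₊) : |x - y| ≤ 1 / s := by
  have h1 := Nat.floor_le (mul_nonneg hx hs.le)
  have h2 := Nat.lt_floor_add_one (x * s)
  have h3 := Nat.floor_le (mul_nonneg hy hs.le)
  have h4 := Nat.lt_floor_add_one (y * s)
  rw [h] at h1 h2
  have e : |x - y| * s = |x * s - y * s| := by rw [← sub_mul, abs_mul, abs_of_pos hs]
  rw [le_div_iff₀ hs, e, abs_le]
  constructor <;> linarith

theorem norm_exp_sub_exp_le (s t : ℝ) : ‖exp (s * I) - exp (t * I)‖ ≤ |s - t| := by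
  have h : exp (s * I) - exp (t * I) = exp (t * I) * (exp (I * (s - t : ℝ)) - 1) := by
    rw [mul_sub, ← Complex.exp_add, mul_one]
    congr 2
    push_cast
    ring
  rw [h, norm_mul, Complex.norm_exp_ofReal_mul_I, one_mul, ← Real.norm_eq_abs]
  exact Real.norm_exp_I_mul_ofReal_sub_one_le

/-- Hence 1 minus a Gram factor is the squared pseudohyperbolic distance. -/
theorem norm_one_sub_mul_conj_sq (z w : ℂ) :
    ‖1 - z * conj w‖ ^ 2 = (1 - ‖z‖ ^ 2) * (1 - ‖w‖ ^ 2) + ‖z - w‖ ^ 2 := by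
  simp only [← Complex.normSq_eq_norm_sq, Complex.normSq_apply]
  simp
  ring

/-- Points at small mutual distance, relative to their distance to the circle, have Gram factor
close to one. -/
theorem one_sub_le_gramFactor {z w : ℂ} (hz : ‖z‖ < 1) (hw : ‖w‖ < 1) {ε : ℝ}
    (h : ‖z - w‖ ≤ ε * (1 - ‖z‖)) :
    1 - ε ^ 2 ≤ (1 - ‖z‖ ^ 2) * (1 - ‖w‖ ^ 2) / ‖1 - z * conj w‖ ^ 2 := by
  have h1 : 1 - ‖z‖ ≤ ‖1 - z * conj w‖ := by
    have := norm_sub_norm_le (1 : ℂ) (z * conj w)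
    rw [norm_one, norm_mul, RCLike.norm_conj] at this
    nlinarith [norm_nonneg z, norm_nonneg w]
  have hpos : 0 < 1 - ‖z‖ := by linarith
  have h2 : 0 < ‖1 - z * conj w‖ := hpos.trans_le h1
  have h3 : ‖z - w‖ ^ 2 ≤ ε ^ 2 * ‖1 - z * conj w‖ ^ 2 := by
    calc ‖z - w‖ ^ 2 ≤ (ε * (1 - ‖z‖)) ^ 2 := by gcongr
      _ = ε ^ 2 * (1 - ‖z‖) ^ 2 := by ring
      _ ≤ _ := by gcongr
  rw [le_div_iff₀ (by positivity)]
  have := norm_one_sub_mul_conj_sq z w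
  linarith

/-- The denominators `Q * 2 ^ m i` of a partition into small boxes. -/
def boxDenom (Q : ℕ) (m : Fin d → ℕ) (i : Fin d) : ℕ := Q * 2 ^ m i

theorem boxDenom_pos {Q : ℕ} (hQ : 0 < Q) (m : Fin d → ℕ) (i : Fin d) : 0 < boxDenom Q m i := by
  rw [boxDenom]; positivity

theorem prod_inv_boxDenom (Q : ℕ) (m : Fin d → ℕ) :
    ∏ i, (boxDenom Q m i : ℝ≥0∞)⁻¹ = ((Q : ℝ≥0∞)⁻¹) ^ d * 2⁻¹ ^ ∑ i, m i := by
  rw [← Finset.prod_pow_eq_pow_sum, ← Fin.prod_const, ← Finset.prod_mul_distrib]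
  refine Finset.prod_congr rfl fun i _ => ?_
  rw [boxDenom, Nat.cast_mul, ENNReal.mul_inv (by simp) (by simp), Nat.cast_pow, ENNReal.inv_pow]
  simp

end Boxes

/-! ### Almost sure failure in the divergent case -/

section Collisions

variable {d : ℕ} {Ω : Type*} {r : ℕ → Fin d → ℝ} {hr : ∀ n i, r n i ∈ Set.Ico (0 : ℝ) 1}
  {θ : ℕ → Ω → Fin d → ℝ} {μ : ℕ → Fin d → ℕ}

/-- The value Q is attained when 1 - r equals 2^(-μ), hence Q + 1 classes rather than Q. -/
theorem IsLevel.floor_le (hμ : IsLevel r μ) (Q n : ℕ) (i : Fin d) :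
    ⌊(1 - r n i) * boxDenom Q (μ n) i⌋₊ < Q + 1 := by
  rw [Nat.lt_succ_iff]
  refine Nat.floor_le_of_le ?_
  rw [boxDenom]
  push_cast
  calc (1 - r n i) * (Q * 2 ^ μ n i) ≤ (2⁻¹ : ℝ) ^ μ n i * (Q * 2 ^ μ n i) := by
        gcongr; exact (hμ n i).2
    _ = Q * ((2⁻¹ : ℝ) * 2) ^ μ n i := by rw [mul_pow]; ring
    _ = Q := by norm_num

/-- The radial class of the `n`-th point: its dyadic shell, divided into `Q + 1` parts. -/
noncomputable def IsLevel.radialClass (hμ : IsLevel r μ) (Q n : ℕ) :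
    (Fin d → ℕ) × (Fin d → Fin (Q + 1)) :=
  (μ n, fun i => ⟨⌊(1 - r n i) * boxDenom Q (μ n) i⌋₊, hμ.floor_le Q n i⟩)

theorem le_norm_inner_sq_of_collision (hμ : IsLevel r μ) {Q : ℕ} (hQ : 16 ≤ Q) {n k : ℕ} {ω : Ω}
    (hn : ∀ i, θ n ω i ∈ Set.Ioo (0 : ℝ) (2 * Real.pi))
    (hk : ∀ i, θ k ω i ∈ Set.Ioo (0 : ℝ) (2 * Real.pi))
    (hc : hμ.radialClass Q k = hμ.radialClass Q n)
    (hb : boxIndex (boxDenom Q (μ k)) (θ k ω) = boxIndex (boxDenom Q (μ n)) (θ n ω)) :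
    (1 - (16 / (Q : ℝ)) ^ 2) ^ d ≤
      ‖inner ℂ (unitKer (randomSeq r hr θ ω n)) (unitKer (randomSeq r hr θ ω k))‖ ^ 2 := by
  have hm : μ k = μ n := congrArg Prod.fst hc
  have hQ0 : (0 : ℝ) < Q := by exact_mod_cast (by omega : 0 < Q)
  have hQ1 : 16 / (Q : ℝ) ≤ 1 := by
    rw [div_le_one hQ0]; exact_mod_cast hQ
  have hq0 : 0 ≤ 16 / (Q : ℝ) := by positivity
  rw [norm_inner_unitKer_sq, ← Fin.prod_const]
  -- Comparing products factorwise needs 1 - (16 / Q)² ≥ 0, which is where Q ≥ 16 enters.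
  refine Finset.prod_le_prod (fun i _ => by nlinarith) fun i _ => ?_
  set z := (randomSeq r hr θ ω n).1 i with hz
  set w := (randomSeq r hr θ ω k).1 i with hw
  have hzn : ‖z‖ = r n i := norm_randomSeq ω n i
  refine one_sub_le_gramFactor ((randomSeq r hr θ ω n).2 i) ((randomSeq r hr θ ω k).2 i) ?_
  set D : ℝ := ((boxDenom Q (μ n) i : ℕ) : ℝ) with hD
  have hDpos : 0 < D := by
    rw [hD]; exact_mod_cast boxDenom_pos (by omega) (μ n) i
  have hfl : ⌊(1 - r k i) * D⌋₊ = ⌊(1 - r n i) * D⌋₊ := by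
    have h := congrArg Fin.val (congrFun (congrArg Prod.snd hc) i)
    simpa [IsLevel.radialClass, hm] using h
  have hrad : |r n i - r k i| ≤ 1 / D := by
    have h := abs_sub_le_of_floor_eq hDpos (by linarith [(hr k i).2]) (by linarith [(hr n i).2]) hfl
    rwa [show 1 - r k i - (1 - r n i) = r n i - r k i by ring] at h
  have hang : |θ n ω i - θ k ω i| ≤ 2 * Real.pi / D := by
    have hpi := Real.two_pi_pos
    have h := congrFun hb i
    rw [hm] at h
    simp only [boxIndex, mul_div_assoc] at h
    have h := abs_sub_le_of_floor_eq (div_pos hDpos hpi) (hn i).1.le (hk i).1.le h.symm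
    rwa [one_div_div] at h
  -- The radial gap is at most 1 / D and the angular gap at most 2π / D, with 1 + 2π < 8. The 16
  -- arises because 1 - r may be as small as half of 2^(-μ).
  have hdist : ‖z - w‖ ≤ 8 / D := by
    have e : z - w = ((r n i - r k i : ℝ) : ℂ) * exp (θ n ω i * I) +
        (r k i : ℂ) * (exp (θ n ω i * I) - exp (θ k ω i * I)) := by
      rw [hz, hw]
      simp only [randomSeq]
      push_cast
      ring
    have h1 : ‖z - w‖ ≤ |r n i - r k i| + r k i * |θ n ω i - θ k ω i| := by
      rw [e]
      refine (norm_add_le _ _).trans (add_le_add (le_of_eq ?_) ?_)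
      · rw [norm_mul, Complex.norm_exp_ofReal_mul_I, mul_one, Complex.norm_real, Real.norm_eq_abs]
      · rw [norm_mul, Complex.norm_real, Real.norm_eq_abs, abs_of_nonneg (hr k i).1]
        exact mul_le_mul_of_nonneg_left (norm_exp_sub_exp_le _ _) (hr k i).1
    calc ‖z - w‖ ≤ |r n i - r k i| + r k i * |θ n ω i - θ k ω i| := h1
      _ ≤ 1 / D + 1 * (2 * Real.pi / D) := by
        gcongr
        exact (hr k i).2.le
      _ = (1 + 2 * Real.pi) / D := by ring
      _ ≤ 8 / D := by
        gcongr
        linarith [Real.pi_lt_d2]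
  refine hdist.trans ?_
  rw [hzn]
  calc 8 / D = 16 / Q * (2⁻¹ : ℝ) ^ (μ n i + 1) := by
        rw [hD, boxDenom]
        push_cast
        rw [inv_pow, pow_succ]
        field_simp
        norm_num
    _ ≤ _ := by
        gcongr
        exact (hμ n i).1.le

variable [MeasurableSpace Ω] {P : Measure Ω}

theorem ae_angle_mem (hθ : ∀ n, Measurable (θ n))
    (hmap : ∀ n, P.map (θ n) = Measure.pi fun _ => angleLaw) :
    ∀ᵐ ω ∂P, ∀ n i, θ n ω i ∈ Set.Ioo (0 : ℝ) (2 * Real.pi) := by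
  rw [ae_all_iff]
  intro n
  have h : ∀ᵐ φ ∂(Measure.pi fun _ : Fin d => angleLaw),
      φ ∈ Set.univ.pi fun _ : Fin d => Set.Ioo (0 : ℝ) (2 * Real.pi) := by
    rw [← cond_pi_eq]
    exact ae_cond_mem (MeasurableSet.univ_pi fun _ => measurableSet_Ioo)
  rw [← hmap n] at h
  filter_upwards [ae_of_ae_map (hθ n).aemeasurable h] with ω hω i
  exact hω i trivial

variable [IsProbabilityMeasure P]

theorem ae_exists_close_pair (hθ : ∀ n, Measurable (θ n)) (hindep : iIndepFun θ P)
    (hmap : ∀ n, P.map (θ n) = Measure.pi fun _ => angleLaw) (hsum : shellSum r = ∞) {Q : ℕ}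
    (hQ : 16 ≤ Q) :
    ∀ᵐ ω ∂P, ∃ n k, n ≠ k ∧ (1 - (16 / (Q : ℝ)) ^ 2) ^ d ≤
      ‖inner ℂ (unitKer (randomSeq r hr θ ω n)) (unitKer (randomSeq r hr θ ω k))‖ ^ 2 := by
  obtain ⟨μ, hμ⟩ := exists_isLevel r hr
  have hQ0 : 0 < Q := by omega
  have hmem := ae_angle_mem hθ hmap
  have hcol := ae_exists_collision
    (X := fun n ω => boxIndex (boxDenom Q (μ n)) (θ n ω))
    (fun n => (measurable_boxIndex _).comp (hθ n))
    (hindep.comp (fun n => boxIndex (boxDenom Q (μ n))) fun n => measurable_boxIndex _)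
    (hμ.radialClass Q) (p := fun n => ∏ i, (boxDenom Q (μ n) i : ℝ≥0∞)⁻¹) ?_ ?_
  · filter_upwards [hcol, hmem] with ω hω hm
    obtain ⟨n, k, hnk, hc, hb⟩ := hω
    exact ⟨n, k, hnk.symm, le_norm_inner_sq_of_collision hμ hQ (hm n) (hm k) hc hb⟩
  · intro n k hc
    have hm : μ k = μ n := congrArg Prod.fst hc
    filter_upwards [hmem] with ω hω
    rw [hm]
    refine (le_pi_angleLaw_boxIndex (boxDenom Q (μ n))
      (boxIndex_lt (boxDenom_pos hQ0 (μ n)) (hω k))).trans (le_of_eq ?_)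
    rw [← hmap n, Measure.map_apply (hθ n) (measurable_boxIndex _ (measurableSet_singleton _))]
    rfl
  · simp only [prod_inv_boxDenom]
    simp_rw [mul_left_comm _ ((Q : ℝ≥0∞)⁻¹ ^ d)]
    rw [ENNReal.tsum_mul_left]
    have h := hμ.tsum_earlierCount_eq_top hsum fun n => (hμ.radialClass Q n).2
    rw [show (∑' n, (earlierCount (hμ.radialClass Q) n : ℝ≥0∞) * 2⁻¹ ^ ∑ i, μ n i) = ∞ from h]
    exact ENNReal.mul_top (pow_ne_zero _ (ENNReal.inv_ne_zero.2 (ENNReal.natCast_ne_top Q)))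

theorem ae_not_isInterpolating (hθ : ∀ n, Measurable (θ n)) (hindep : iIndepFun θ P)
    (hmap : ∀ n, P.map (θ n) = Measure.pi fun _ => angleLaw) (hsum : shellSum r = ∞) :
    ∀ᵐ ω ∂P, ¬ IsInterpolating (randomSeq r hr θ ω) := by
  -- Only countably many Q occur, so one null set serves all; letting Q tend to infinity contradicts
  -- separation.
  have h : ∀ᵐ ω ∂P, ∀ Q : ℕ, 16 ≤ Q → ∃ n k, n ≠ k ∧ (1 - (16 / (Q : ℝ)) ^ 2) ^ d ≤
      ‖inner ℂ (unitKer (randomSeq r hr θ ω n)) (unitKer (randomSeq r hr θ ω k))‖ ^ 2 := by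
    rw [ae_all_iff]
    intro Q
    by_cases hQ : 16 ≤ Q
    · filter_upwards [ae_exists_close_pair (hr := hr) hθ hindep hmap hsum hQ] with ω hω _
      exact hω
    · exact Filter.Eventually.of_forall fun ω h => absurd h hQ
  filter_upwards [h] with ω hω hint
  obtain ⟨δ, hδ, hsep⟩ := hint.exists_separation
  have hlim : Filter.Tendsto (fun Q : ℕ => (1 - (16 / (Q : ℝ)) ^ 2) ^ d) Filter.atTop
      (nhds ((1 - 0 ^ 2) ^ d)) :=
    (tendsto_const_nhds.sub ((tendsto_const_div_atTop_nhds_zero_nat 16).pow 2)).pow d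
  have hev := hlim.eventually (lt_mem_nhds (a := 1 - δ) (by norm_num; exact hδ))
  obtain ⟨Q, hQ1, hQ2⟩ := (hev.and (Filter.eventually_ge_atTop 16)).exists
  obtain ⟨n, k, hnk, hle⟩ := hω Q hQ2
  linarith [hsep n k hnk]

end Collisions
end RandomHardy

theorem theorem1p5 (d : ℕ) (hd : 1 ≤ d)
    {Ω : Type*} [MeasurableSpace Ω] (P : Measure Ω) [IsProbabilityMeasure P]
    (r : ℕ → Fin d → ℝ) (hr : ∀ n i, r n i ∈ Set.Ico (0 : ℝ) 1)
    (θ : ℕ → Ω → Fin d → ℝ) (hθ : ∀ n, Measurable (θ n))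
    (hindep : iIndepFun θ P)
    (hunif : ∀ n, pdf.IsUniform (θ n)
      (Set.univ.pi fun _ : Fin d => Set.Ioo (0 : ℝ) (2 * Real.pi)) P volume) :
    (RandomHardy.shellSum r < ∞ → (∀ n k, r n = 0 → r k = 0 → n = k) →
      ∀ᵐ ω ∂P, RandomHardy.IsInterpolating (RandomHardy.randomSeq r hr θ ω)) ∧
    (RandomHardy.shellSum r = ∞ →
      ∀ᵐ ω ∂P, ¬ RandomHardy.IsInterpolating (RandomHardy.randomSeq r hr θ ω)) := by
  have hmap : ∀ n, P.map (θ n) = Measure.pi fun _ => RandomHardy.angleLaw := fun n =>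
    (hunif n).trans (RandomHardy.cond_pi_eq d)
  exact ⟨fun hsum h0 => RandomHardy.ae_isInterpolating hθ hindep hmap hsum h0,
    fun hsum => RandomHardy.ae_not_isInterpolating hθ hindep hmap hsum⟩
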